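/- All graphs are finite, simple and undirected, and may be disconnected. For a graph $G=(V_G,E_G)$ write $\mathrm{CC}(G)$ for its set of connected components and $G[S]$ for the subgraph induced by $S\subseteq V_G$. **Biconnectivity.** A vertex $v$ is a *cut vertex* of $G$ if $|\mathrm{CC}(G[V_G\setminus\{v\}])|>|\mathrm{CC}(G)|$, and an edge $e\in E_G$ is a *cut edge* if $|\mathrm{CC}(G-e)|>|\mathrm{CC}(G)|$. $G$ is *vertex-biconnected* (resp. *edge-biconnected*) if it is connected, hence nonempty, and has no cut vertex (resp. cut edge). A set $S\subseteq V_G$ is a *vertex-biconnected* (resp. *edge-biconnected*) *component* of $G$ if $G[S]$ is vertex-biconnected (resp. edge-biconnected) and $G[S']$ is not for any $S'\supsetneq S$. The *block cut-vertex tree* $\mathrm{BCVTree}(G)$ is the graph whose nodes are the vertex-biconnected components and the cut vertices of $G$, with an edge between a component $S$ and a cut vertex $v$ exactly when $v\in S$. The *block cut-edge tree* $\mathrm{BCETree}(G)$ is the graph whose nodes are the edge-biconnected components of $G$, with an edge between two different components $S_1,S_2$ exactly when some $\{a,b\}\in E_G$ has $a\in S_1$, $b\in S_2$. **GD-WL.**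 Let $\mathrm{dis}_G$ be the shortest-path distance and $\mathrm{dis}^{\mathrm R}_G$ the resistance distance (the effective resistance when every edge is a resistor of one ohm), both equal to $\infty$ between different connected components, and put $d_G(u,v):=(\mathrm{dis}_G(u,v),\mathrm{dis}^{\mathrm R}_G(u,v))$. Let $\mathcal C$ be a set of colors, $c_0\in\mathcal C$, let $\mathrm{hash}$ be an injective map from the finite multisets with elements in $(\mathbb N\cup\{\infty\})\times[0,\infty]\times\mathcal C$ to $\mathcal C$, and define, for $v\in V_G$ and $t\ge 1$, $$\chi_G^0(v):=c_0,\qquad \chi_G^t(v):=\mathrm{hash}\big(\{\!\{(d_G(v,u),\chi_G^{t-1}(u)):u\in V_G\}\!\}\big).$$ Let $T:\mathbb N\to\mathbb N$ be any function with $T(n)\ge n$ for all $n$. GD-WL outputs $\chi_G:=\chi_G^{T(|V_G|)}$; the representation of $G$ is the multiset $\{\!\{\chi_G(u):u\in V_G\}\!\}$. **Corollary.** GD-WL with $d_G=(\mathrm{dis}_G,\mathrm{dis}^{\mathrm R}_G)$ is fully expressive for both vertex-biconnectivity and edge-biconnectivity. That is, for all graphs $G,H$: 1. if $G$ is vertex-biconnected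 and $H$ is not, then $G$ and $H$ have different representations; if $G$ is edge-biconnected and $H$ is not, then $G$ and $H$ have different representations; 2. if $u\in V_G$ is a cut vertex of $G$ and $v\in V_H$ is not a cut vertex of $H$, then $\chi_G(u)\ne\chi_H(v)$; 3. if $\{u,v\}\in E_G$ is a cut edge of $G$ and $\{w,x\}\in E_H$ is not a cut edge of $H$, then $\{\!\{\chi_G(u),\chi_G(v)\}\!\}\ne\{\!\{\chi_H(w),\chi_H(x)\}\!\}$; 4. if $\mathrm{BCVTree}(G)\not\simeq\mathrm{BCVTree}(H)$ or $\mathrm{BCETree}(G)\not\simeq\mathrm{BCETree}(H)$, then $G$ and $H$ have different representations. -/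

import Mathlib

open scoped ENNReal

universe u v

namespace GDWL

/-! ### Biconnectivity -/

section Biconnectivity

variable {V : Type u}

/-- `v` is a cut vertex of `G`: removing `v` increases the number of connected components. -/
def IsCutVertex (G : SimpleGraph V) (v : V) : Prop :=
  Nat.card G.ConnectedComponent < Nat.card (G.induce ({v}ᶜ : Set V)).ConnectedComponent

/-- `e` is a cut edge (bridge) of `G`: it is an edge of `G`, and removing it increases the number
of connected components. -/
def IsCutEdge (G : SimpleGraph V) (e : Sym2 V) : Prop :=
  e ∈ G.edgeSet ∧
    Nat.card G.ConnectedComponent < Nat.card (G.deleteEdges {e}).ConnectedComponent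

/-- `G` is vertex-biconnected: connected (in particular nonempty) and without cut vertices. -/
def VertexBiconnected (G : SimpleGraph V) : Prop :=
  G.Connected ∧ ∀ v, ¬ IsCutVertex G v

/-- `G` is edge-biconnected: connected (in particular nonempty) and without cut edges. -/
def EdgeBiconnected (G : SimpleGraph V) : Prop :=
  G.Connected ∧ ∀ e, ¬ IsCutEdge G e

/-- `S` is a vertex-biconnected component of `G`: `G[S]` is vertex-biconnected and `G[T]` is not,
for every proper superset `T` of `S`. -/
def IsVertexBCC (G : SimpleGraph V) (S : Set V) : Prop :=
  VertexBiconnected (G.induce S) ∧ ∀ T : Set V, S ⊂ T → ¬ VertexBiconnected (G.induce T)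

/-- `S` is an edge-biconnected component of `G`: `G[S]` is edge-biconnected and `G[T]` is not,
for every proper superset `T` of `S`. -/
def IsEdgeBCC (G : SimpleGraph V) (S : Set V) : Prop :=
  EdgeBiconnected (G.induce S) ∧ ∀ T : Set V, S ⊂ T → ¬ EdgeBiconnected (G.induce T)

/-- The block cut-vertex tree of `G` (a forest if `G` is disconnected). Its nodes are the
vertex-biconnected components and the cut vertices of `G`; a component `S` and a cut vertex `v`
are joined iff `v ∈ S`, and there are no other edges. -/
def BCVTree (G : SimpleGraph V) :
    SimpleGraph ({S : Set V // IsVertexBCC G S} ⊕ {v : V // IsCutVertex G v}) :=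
  SimpleGraph.fromRel fun a b =>
    ∃ (S : {S : Set V // IsVertexBCC G S}) (v : {v : V // IsCutVertex G v}),
      a = Sum.inl S ∧ b = Sum.inr v ∧ v.1 ∈ S.1

/-- The block cut-edge tree of `G` (a forest if `G` is disconnected). Its nodes are the
edge-biconnected components of `G`; two different components are joined iff some edge of `G`
runs between them. -/
def BCETree (G : SimpleGraph V) : SimpleGraph {S : Set V // IsEdgeBCC G S} :=
  SimpleGraph.fromRel fun S₁ S₂ => ∃ a ∈ S₁.1, ∃ b ∈ S₂.1, G.Adj a b

end Biconnectivity

/-! ### Shortest-path distance and resistance distance -/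

section Distances

variable {V : Type u} [Fintype V]

open Classical in
/-- `φ` is an electric potential on `G`, every edge being a resistor of one ohm, when one ampere
is injected at `a` and extracted at `b`: by Ohm's law the current along an edge `x y` is
`φ x - φ y`, and by Kirchhoff's law the net current leaving `x` is the one injected at `x`. -/
def IsUnitCurrentPotential (G : SimpleGraph V) (a b : V) (φ : V → ℝ) : Prop :=
  ∀ x, ∑ y with G.Adj x y, (φ x - φ y) = (if x = a then 1 else 0) - (if x = b then 1 else 0)

/-- The resistance distance: the voltage between `a` and `b` when a unit current flows
from `a` to `b`. If `a` and `b` are connected, all potentials as above have the same voltage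
`φ a - φ b`; if they are not, there is no such potential and the value is `∞`. -/
noncomputable def resistanceDist (G : SimpleGraph V) (a b : V) : ℝ≥0∞ :=
  ⨅ (φ : V → ℝ) (_ : IsUnitCurrentPotential G a b φ), ENNReal.ofReal (φ a - φ b)

/-- The pair of the shortest-path distance (`∞` between different connected components) and the
resistance distance. -/
noncomputable def spdRd (G : SimpleGraph V) (a b : V) : ℕ∞ × ℝ≥0∞ :=
  (G.edist a b, resistanceDist G a b)

end Distances

/-! ### Color refinement and GD-WL -/

/-- The color mappings of the Generalized Distance Weisfeiler-Lehman algorithm with distance `d`,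
hash function `hash` and initial color `c₀`, after `0, 1, 2, …` iterations. -/
def gdwlColor {V : Type u} [Fintype V] {D C : Type*} (hash : Multiset (D × C) → C) (c₀ : C)
    (d : V → V → D) : ℕ → V → C
  | 0, _ => c₀
  | t + 1, a => hash (Finset.univ.val.map fun b => (d a b, gdwlColor hash c₀ d t b))

/-- A (color refinement) algorithm: it takes a finite graph and outputs a color mapping. -/
abbrev ColorAlgorithm (C : Type v) : Type (max (u + 1) v) :=
  (V : Type u) → [Fintype V] → SimpleGraph V → V → C

/-- GD-WL with the pair (shortest-path distance, resistance distance), run for `T n` iterations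
on graphs with `n` vertices. -/
noncomputable def gdwlSpdRd {C : Type v} (hash : Multiset ((ℕ∞ × ℝ≥0∞) × C) → C) (c₀ : C)
    (T : ℕ → ℕ) : ColorAlgorithm.{u, v} C :=
  fun V _ G => gdwlColor hash c₀ (spdRd G) (T (Fintype.card V))

section Expressiveness

variable {C : Type v}

/-- The graph representation of `G`: the multiset of the colors of its vertices. -/
def graphRep (A : ColorAlgorithm.{u, v} C) {V : Type u} [Fintype V] (G : SimpleGraph V) :
    Multiset C :=
  Finset.univ.val.map (A V G)

/-- `A` distinguishes whether a graph is vertex-biconnected. -/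
def DistinguishesVertexBiconnected (A : ColorAlgorithm.{u, v} C) : Prop :=
  ∀ (V W : Type u) [Fintype V] [Fintype W] (G : SimpleGraph V) (H : SimpleGraph W),
    VertexBiconnected G → ¬ VertexBiconnected H → graphRep A G ≠ graphRep A H

/-- `A` distinguishes whether a graph is edge-biconnected. -/
def DistinguishesEdgeBiconnected (A : ColorAlgorithm.{u, v} C) : Prop :=
  ∀ (V W : Type u) [Fintype V] [Fintype W] (G : SimpleGraph V) (H : SimpleGraph W),
    EdgeBiconnected G → ¬ EdgeBiconnected H → graphRep A G ≠ graphRep A H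

/-- `A` identifies cut vertices, by the node colors. -/
def IdentifiesCutVertices (A : ColorAlgorithm.{u, v} C) : Prop :=
  ∀ (V W : Type u) [Fintype V] [Fintype W] (G : SimpleGraph V) (H : SimpleGraph W)
    (a : V) (b : W), IsCutVertex G a → ¬ IsCutVertex H b → A V G a ≠ A W H b

/-- `A` identifies cut edges, by the unordered pairs (two-element multisets) of the colors of the
two endpoints. -/
def IdentifiesCutEdges (A : ColorAlgorithm.{u, v} C) : Prop :=
  ∀ (V W : Type u) [Fintype V] [Fintype W] (G : SimpleGraph V) (H : SimpleGraph W)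
    (a₁ a₂ : V) (b₁ b₂ : W), G.Adj a₁ a₂ → H.Adj b₁ b₂ →
      IsCutEdge G s(a₁, a₂) → ¬ IsCutEdge H s(b₁, b₂) →
        s(A V G a₁, A V G a₂) ≠ s(A W H b₁, A W H b₂)

/-- `A` distinguishes graphs with non-isomorphic block cut-vertex trees. -/
def DistinguishesBCVTrees (A : ColorAlgorithm.{u, v} C) : Prop :=
  ∀ (V W : Type u) [Fintype V] [Fintype W] (G : SimpleGraph V) (H : SimpleGraph W),
    ¬ Nonempty (BCVTree G ≃g BCVTree H) → graphRep A G ≠ graphRep A H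

/-- `A` distinguishes graphs with non-isomorphic block cut-edge trees. -/
def DistinguishesBCETrees (A : ColorAlgorithm.{u, v} C) : Prop :=
  ∀ (V W : Type u) [Fintype V] [Fintype W] (G : SimpleGraph V) (H : SimpleGraph W),
    ¬ Nonempty (BCETree G ≃g BCETree H) → graphRep A G ≠ graphRep A H

/-- `A` is fully expressive for vertex-biconnectivity. -/
def FullyExpressiveVertex (A : ColorAlgorithm.{u, v} C) : Prop :=
  DistinguishesVertexBiconnected A ∧ IdentifiesCutVertices A ∧ DistinguishesBCVTrees A

/-- `A` is fully expressive for edge-biconnectivity. -/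
def FullyExpressiveEdge (A : ColorAlgorithm.{u, v} C) : Prop :=
  DistinguishesEdgeBiconnected A ∧ IdentifiesCutEdges A ∧ DistinguishesBCETrees A

end Expressiveness

end GDWL

namespace GDWL

/-! ### Stabilisation of colour refinement -/

section Stabilisation

variable {C : Type v} {D : Type*}

/-- The colouring `f` is stable: the colour of a vertex determines the multiset of the distances
and colours of all vertices as seen from it, by the table `prof`. -/
def IsStable {V : Type u} [Fintype V] (d : V → V → D) (f : V → C)
    (prof : C → Multiset (D × C)) : Prop :=
  ∀ x, (Finset.univ.val.map fun y => (d x y, f y)) = prof (f x)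

variable {hash : Multiset (D × C) → C} {c₀ : C}

lemma gdwlColor_succ {V : Type u} [Fintype V] (d : V → V → D) (t : ℕ) (x : V) :
    gdwlColor hash c₀ d (t + 1) x =
      hash (Finset.univ.val.map fun y => (d x y, gdwlColor hash c₀ d t y)) := rfl

lemma exists_gdwlColor_eq_comp_succ (hash_injective : Function.Injective hash) (t : ℕ) :
    ∃ h : C → C, ∀ (V : Type u) [Fintype V] (d : V → V → D) (x : V),
      gdwlColor hash c₀ d t x = h (gdwlColor hash c₀ d (t + 1) x) := by
  induction t with
  | zero => exact ⟨fun _ => c₀, fun _ _ _ _ => rfl⟩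
  | succ t ih =>
    obtain ⟨h, hh⟩ := ih
    refine ⟨fun c => hash ((Function.invFun hash c).map (Prod.map id h)), fun V _ d x => ?_⟩
    rw [gdwlColor_succ d (t + 1)]
    beta_reduce
    rw [Function.leftInverse_invFun hash_injective, Multiset.map_map,
      gdwlColor_succ]
    congr 2
    funext y
    simp only [Function.comp_apply, Prod.map_apply, id_eq, hh V d y]

lemma exists_gdwlColor_eq_comp (hash_injective : Function.Injective hash) {s t : ℕ}
    (hst : s ≤ t) : ∃ h : C → C, ∀ (V : Type u) [Fintype V] (d : V → V → D) (x : V),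
      gdwlColor hash c₀ d s x = h (gdwlColor hash c₀ d t x) := by
  induction t, hst using Nat.le_induction with
  | base => exact ⟨id, fun _ _ _ _ => rfl⟩
  | succ t _ ih =>
    obtain ⟨h, hh⟩ := ih
    obtain ⟨h', hh'⟩ := exists_gdwlColor_eq_comp_succ (c₀ := c₀) hash_injective t
    exact ⟨h ∘ h', fun V _ d x => by rw [hh, hh', Function.comp_apply]⟩

variable {V W : Type u} [Fintype V] [Fintype W] {d : V → V → D} {d' : W → W → D}

/-- The colours of two graphs after `t` iterations. -/
def jointColor (hash : Multiset (D × C) → C) (c₀ : C) (d : V → V → D) (d' : W → W → D) (t : ℕ) :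
    V ⊕ W → C :=
  Sum.elim (gdwlColor hash c₀ d t) (gdwlColor hash c₀ d' t)

/-- Both graphs have a stable colouring, with the same table and the same colours, which is coarser
than the colouring after `T` iterations. -/
def StableBelow (hash : Multiset (D × C) → C) (c₀ : C) (d : V → V → D) (d' : W → W → D)
    (T : ℕ) : Prop :=
  ∃ (f : V → C) (g : W → C) (prof : C → Multiset (D × C)) (h : C → C),
    IsStable d f prof ∧ IsStable d' g prof ∧ Finset.univ.val.map f = Finset.univ.val.map g ∧
      (∀ x, f x = h (gdwlColor hash c₀ d T x)) ∧ ∀ y, g y = h (gdwlColor hash c₀ d' T y)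

lemma stableBelow_of_factors (hash_injective : Function.Injective hash) {t T : ℕ} (htT : t ≤ T)
    (hmap : Finset.univ.val.map (gdwlColor hash c₀ d t) =
      Finset.univ.val.map (gdwlColor hash c₀ d' t))
    (h : (jointColor hash c₀ d d' (t + 1)).FactorsThrough (jointColor hash c₀ d d' t)) :
    StableBelow hash c₀ d d' T := by
  obtain ⟨g, hg⟩ := exists_gdwlColor_eq_comp (c₀ := c₀) hash_injective htT
  set ms : V ⊕ W → Multiset (D × C) := Sum.elim
    (fun x => Finset.univ.val.map fun y => (d x y, gdwlColor hash c₀ d t y))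
    (fun x => Finset.univ.val.map fun y => (d' x y, gdwlColor hash c₀ d' t y)) with hms
  have hjoint : ∀ z, jointColor hash c₀ d d' (t + 1) z = hash (ms z) := by
    rintro (x | y) <;> rfl
  have hfac : ms.FactorsThrough (jointColor hash c₀ d d' t) := fun z z' hz =>
    hash_injective (by rw [← hjoint, ← hjoint, h hz])
  refine ⟨gdwlColor hash c₀ d t, gdwlColor hash c₀ d' t,
    Function.extend (jointColor hash c₀ d d' t) ms 0, g, fun x => ?_, fun y => ?_, hmap,
    hg V d, hg W d'⟩
  · exact (hfac.extend_apply 0 (Sum.inl x)).symm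
  · exact (hfac.extend_apply 0 (Sum.inr y)).symm

open Classical in
lemma exists_factors_or_le_card (hash_injective : Function.Injective hash) [Nonempty V] (n : ℕ) :
    (∃ t < n, (jointColor hash c₀ d d' (t + 1)).FactorsThrough (jointColor hash c₀ d d' t)) ∨
      n + 1 ≤ (Finset.univ.image (jointColor hash c₀ d d' n)).card := by
  induction n with
  | zero =>
    right
    rw [Nat.succ_le_iff, Finset.card_pos]
    exact ⟨_, Finset.mem_image_of_mem _ (Finset.mem_univ (Sum.inl (Classical.arbitrary V)))⟩
  | succ n ih =>
    rcases ih with ⟨t, ht, h⟩ | ih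
    · exact .inl ⟨t, by omega, h⟩
    by_cases hf : (jointColor hash c₀ d d' (n + 1)).FactorsThrough (jointColor hash c₀ d d' n)
    · exact .inl ⟨n, by omega, hf⟩
    right
    obtain ⟨h, hh⟩ := exists_gdwlColor_eq_comp_succ (c₀ := c₀) hash_injective n
    have hc : ∀ z, jointColor hash c₀ d d' n z = h (jointColor hash c₀ d d' (n + 1) z) := by
      rintro (x | y)
      exacts [hh V d x, hh W d' y]
    have himg : Finset.univ.image (jointColor hash c₀ d d' n) =
        (Finset.univ.image (jointColor hash c₀ d d' (n + 1))).image h := by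
      rw [Finset.image_image]
      exact Finset.image_congr fun z _ => hc z
    refine lt_of_le_of_lt ih (lt_of_le_of_ne (himg ▸ Finset.card_image_le) fun heq => hf ?_)
    rw [himg] at heq
    have hinj := Finset.injOn_of_card_image_eq heq
    intro z z' hz
    rw [hc, hc] at hz
    exact hinj (by simp) (by simp) hz

open Classical in
lemma image_jointColor {t : ℕ} (hmap : Finset.univ.val.map (gdwlColor hash c₀ d t) =
      Finset.univ.val.map (gdwlColor hash c₀ d' t)) :
    Finset.univ.image (jointColor hash c₀ d d' t) =
      Finset.univ.image (gdwlColor hash c₀ d t) := by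
  have hmem : ∀ c, c ∈ Finset.univ.val.map (gdwlColor hash c₀ d t) ↔
      c ∈ Finset.univ.val.map (gdwlColor hash c₀ d' t) := fun c => by rw [hmap]
  ext c
  have := hmem c
  simp only [Multiset.mem_map, Finset.mem_val, Finset.mem_univ, true_and] at this
  simp [jointColor, ← this]

lemma map_gdwlColor_of_le (hash_injective : Function.Injective hash) {s t : ℕ} (hst : s ≤ t)
    (hmap : Finset.univ.val.map (gdwlColor hash c₀ d t) =
      Finset.univ.val.map (gdwlColor hash c₀ d' t)) :
    Finset.univ.val.map (gdwlColor hash c₀ d s) =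
      Finset.univ.val.map (gdwlColor hash c₀ d' s) := by
  obtain ⟨h, hh⟩ := exists_gdwlColor_eq_comp (c₀ := c₀) hash_injective hst
  have h1 : gdwlColor hash c₀ d s = h ∘ gdwlColor hash c₀ d t := funext (hh V d)
  have h2 : gdwlColor hash c₀ d' s = h ∘ gdwlColor hash c₀ d' t := funext (hh W d')
  rw [h1, h2, ← Multiset.map_map, ← Multiset.map_map, hmap]

lemma stableBelow_of_map_eq (hash_injective : Function.Injective hash) {t T : ℕ}
    (ht : Fintype.card V ≤ t) (htT : t ≤ T)
    (hmap : Finset.univ.val.map (gdwlColor hash c₀ d t) =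
      Finset.univ.val.map (gdwlColor hash c₀ d' t)) : StableBelow hash c₀ d d' T := by
  classical
  rcases isEmpty_or_nonempty V with hV | hV
  · have hW : IsEmpty W := by
      have := congrArg Multiset.card hmap
      rw [Multiset.card_map, Multiset.card_map] at this
      rw [← Fintype.card_eq_zero_iff]
      exact this.symm.trans Fintype.card_eq_zero
    refine stableBelow_of_factors hash_injective (Nat.zero_le T)
      (map_gdwlColor_of_le hash_injective (Nat.zero_le t) hmap) ?_
    rintro (x | y)
    exacts [hV.elim x, hW.elim y]
  · rcases exists_factors_or_le_card (c₀ := c₀) (d := d) (d' := d') hash_injective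
      (Fintype.card V) with ⟨s, hs, h⟩ | h
    · exact stableBelow_of_factors hash_injective (by omega)
        (map_gdwlColor_of_le hash_injective (by omega) hmap) h
    · rw [image_jointColor (map_gdwlColor_of_le hash_injective ht hmap)] at h
      have : (Finset.univ.image (gdwlColor hash c₀ d (Fintype.card V))).card ≤ Fintype.card V :=
        Finset.card_image_le
      omega

lemma map_gdwlColor_of_eq (hash_injective : Function.Injective hash) {t : ℕ} {x : V} {y : W}
    (h : gdwlColor hash c₀ d (t + 1) x = gdwlColor hash c₀ d' (t + 1) y) :
    (Finset.univ.val.map fun z => (d x z, gdwlColor hash c₀ d t z)) =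
      Finset.univ.val.map fun z => (d' y z, gdwlColor hash c₀ d' t z) :=
  hash_injective h

open Classical in
lemma filter_color_eq {t : ℕ} {x : V} {y : W}
    (h : (Finset.univ.val.map fun z => (d x z, gdwlColor hash c₀ d t z)) =
      Finset.univ.val.map fun z => (d' y z, gdwlColor hash c₀ d' t z)) (c : C) :
    ((Finset.univ.filter fun z => gdwlColor hash c₀ d t z = c).val.map (d x)) =
      (Finset.univ.filter fun z => gdwlColor hash c₀ d' t z = c).val.map (d' y) := by
  have := congrArg (fun m => (m.filter fun e : D × C => e.2 = c).map Prod.fst) h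
  simpa only [Multiset.filter_map, Multiset.map_map, Finset.filter_val, Function.comp_def]
    using this

open Classical in
lemma pair_eq_of_card_le_card_image {α β : Type*} [Fintype α] {F : α → β}
    (h : Fintype.card α ≤ (Finset.univ.image F).card + 1) {a b c e : α} (hab : F a = F b)
    (hne : a ≠ b) (hce : F c = F e) (hne' : c ≠ e) : c = a ∨ c = b := by
  by_contra hn
  rw [not_or] at hn
  have hsub : Finset.univ.image F ⊆ ((Finset.univ.erase a).erase c).image F := by
    intro y hy
    obtain ⟨x, -, rfl⟩ := Finset.mem_image.1 hy
    rw [Finset.mem_image]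
    by_cases hxa : x = a
    · exact ⟨b, by simp [Ne.symm hne, Ne.symm hn.2], by rw [hxa, hab]⟩
    by_cases hxc : x = c
    · by_cases hea : e = a
      · exact ⟨b, by simp [Ne.symm hne, Ne.symm hn.2], by rw [hxc, hce, hea, hab]⟩
      · exact ⟨e, by simp [hea, Ne.symm hne'], by rw [hxc, hce]⟩
    · exact ⟨x, by simp [hxa, hxc], rfl⟩
  have h1 := (Finset.card_le_card hsub).trans Finset.card_image_le
  rw [Finset.card_erase_of_mem (by simp [hn.1]), Finset.card_erase_of_mem (by simp)] at h1
  have h2 : 1 < Fintype.card α := Fintype.one_lt_card_iff.2 ⟨a, b, hne⟩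
  rw [Finset.card_univ] at h1
  omega

open Classical in
/-- If only one pair of vertices has not been told apart before the colouring becomes discrete,
then the colours determine the distances. -/
lemma dist_eq_of_discrete (hash_injective : Function.Injective hash) {δ : D}
    (hd : ∀ x y, d x y = d y x) (hd' : ∀ x y, d' x y = d' y x)
    (hd₀ : ∀ x, d x x = δ) (hd₀' : ∀ x, d' x x = δ) {t : ℕ}
    (hcard : Fintype.card V ≤ (Finset.univ.image (gdwlColor hash c₀ d t)).card + 1)
    (hinj : Function.Injective (gdwlColor hash c₀ d (t + 1)))
    (hinj' : Function.Injective (gdwlColor hash c₀ d' (t + 1))) {u x : V} {u' x' : W}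
    (hu : gdwlColor hash c₀ d (t + 1) u = gdwlColor hash c₀ d' (t + 1) u')
    (hx : gdwlColor hash c₀ d (t + 1) x = gdwlColor hash c₀ d' (t + 1) x') : d u x = d' u' x' := by
  classical
  obtain ⟨h, hh⟩ := exists_gdwlColor_eq_comp_succ (c₀ := c₀) hash_injective t
  have hlow : ∀ {u : V} {u' : W},
      gdwlColor hash c₀ d (t + 1) u = gdwlColor hash c₀ d' (t + 1) u' →
      gdwlColor hash c₀ d t u = gdwlColor hash c₀ d' t u' := by
    intro u u' hu
    rw [hh V d, hh W d', hu]
  by_cases hux : u = x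
  · subst hux
    rw [hinj' (hu.symm.trans hx), hd₀, hd₀']
  have hux' : u' ≠ x' := by
    rintro rfl
    exact hux (hinj (hu.trans hx.symm))
  have single : ∀ {u x : V} {u' x' : W},
      gdwlColor hash c₀ d (t + 1) u = gdwlColor hash c₀ d' (t + 1) u' →
      gdwlColor hash c₀ d (t + 1) x = gdwlColor hash c₀ d' (t + 1) x' →
      (∀ z, gdwlColor hash c₀ d t z = gdwlColor hash c₀ d t x → z = x) → d u x = d' u' x' := by
    intro u x u' x' hu hx hs
    have h1 := filter_color_eq (map_gdwlColor_of_eq hash_injective hu) (gdwlColor hash c₀ d t x)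
    have h2 : (Finset.univ.filter fun z => gdwlColor hash c₀ d t z = gdwlColor hash c₀ d t x) =
        {x} := by
      ext z
      simp only [Finset.mem_filter, Finset.mem_univ, true_and, Finset.mem_singleton]
      exact ⟨hs z, fun h => by rw [h]⟩
    have h3 : d' u' x' ∈ (Finset.univ.filter fun z => gdwlColor hash c₀ d' t z =
        gdwlColor hash c₀ d t x).val.map (d' u') :=
      Multiset.mem_map_of_mem _ (by simp [hlow hx])
    rw [← h1, h2] at h3
    simpa using (Multiset.mem_singleton.1 h3).symm
  by_cases hsx : ∀ z, gdwlColor hash c₀ d t z = gdwlColor hash c₀ d t x → z = x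
  · exact single hu hx hsx
  by_cases hsu : ∀ z, gdwlColor hash c₀ d t z = gdwlColor hash c₀ d t u → z = u
  · rw [hd, hd']
    exact single hx hu hsu
  push Not at hsx hsu
  obtain ⟨y, hy, hyx⟩ := hsx
  obtain ⟨w, hw, hwu⟩ := hsu
  have huy : u = y := (pair_eq_of_card_le_card_image hcard hy hyx hw.symm hwu.symm).resolve_right
    hux
  subst huy
  have h1 := filter_color_eq (map_gdwlColor_of_eq hash_injective hu) (gdwlColor hash c₀ d t x)
  have h2 : (Finset.univ.filter fun z => gdwlColor hash c₀ d t z = gdwlColor hash c₀ d t x) =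
      {u, x} := by
    ext z
    simp only [Finset.mem_filter, Finset.mem_univ, true_and, Finset.mem_insert,
      Finset.mem_singleton]
    constructor
    · intro hz
      by_cases hzx : z = x
      · exact .inr hzx
      · exact pair_eq_of_card_le_card_image hcard hy hyx hz hzx
    · rintro (rfl | rfl)
      exacts [hy, rfl]
  have h3 : ({u', x'} : Finset W) = Finset.univ.filter fun z =>
      gdwlColor hash c₀ d' t z = gdwlColor hash c₀ d t x := by
    refine Finset.eq_of_subset_of_card_le ?_ ?_
    · intro z hz
      rw [Finset.mem_insert, Finset.mem_singleton] at hz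
      rcases hz with rfl | rfl
      · simp [← hlow hu, hy]
      · simp [← hlow hx]
    · have h4 := congrArg Multiset.card h1
      rw [Multiset.card_map, Multiset.card_map, h2] at h4
      rw [Finset.card_pair hux']
      exact (h4.symm.trans (Finset.card_pair hux)).le
  rw [h2, ← h3, Finset.insert_val_of_notMem (by simpa using hux),
    Finset.insert_val_of_notMem (by simpa using hux')] at h1
  simpa [hd₀, hd₀'] using h1

lemma stableBelow_of_color_eq (hash_injective : Function.Injective hash) {δ : D}
    (hd : ∀ x y, d x y = d y x) (hd' : ∀ x y, d' x y = d' y x)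
    (hd₀ : ∀ x, d x x = δ) (hd₀' : ∀ x, d' x x = δ) {T : ℕ} (hT : Fintype.card V ≤ T)
    {x : V} {y : W} (hxy : gdwlColor hash c₀ d T x = gdwlColor hash c₀ d' T y) :
    StableBelow hash c₀ d d' T := by
  classical
  have hne : Nonempty V := ⟨x⟩
  have hpos : 0 < Fintype.card V := Fintype.card_pos
  obtain ⟨s, rfl⟩ : ∃ s, T = s + 1 := ⟨T - 1, by omega⟩
  have hmap : Finset.univ.val.map (gdwlColor hash c₀ d s) =
      Finset.univ.val.map (gdwlColor hash c₀ d' s) := by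
    have := congrArg (Multiset.map Prod.snd) (map_gdwlColor_of_eq hash_injective hxy)
    simpa only [Multiset.map_map, Function.comp_def] using this
  by_cases hs : Fintype.card V ≤ s
  · exact stableBelow_of_map_eq hash_injective hs (by omega) hmap
  have hsV : Fintype.card V = s + 1 := by omega
  rcases exists_factors_or_le_card (c₀ := c₀) (d := d) (d' := d') hash_injective s
    with ⟨t, ht, h⟩ | h
  · exact stableBelow_of_factors hash_injective (by omega)
      (map_gdwlColor_of_le hash_injective (by omega) hmap) h
  have hcardW : Fintype.card W = Fintype.card V := by
    have := congrArg Multiset.card hmap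
    rw [Multiset.card_map, Multiset.card_map] at this
    exact this.symm
  have hinj : Function.Injective (gdwlColor hash c₀ d s) := by
    rw [image_jointColor hmap] at h
    have := Finset.injOn_of_card_image_eq (s := (Finset.univ : Finset V))
      (le_antisymm Finset.card_image_le (by rw [Finset.card_univ, hsV]; exact h))
    exact fun a b hab => this (by simp) (by simp) hab
  have hinj' : Function.Injective (gdwlColor hash c₀ d' s) := by
    have hnd := (Multiset.nodup_map_iff_inj_on Finset.univ.nodup).2 fun a _ b _ hab => hinj hab
    rw [hmap] at hnd
    exact fun a b hab => Multiset.inj_on_of_nodup_map hnd a (Finset.mem_univ_val a) b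
      (Finset.mem_univ_val b) hab
  have hlow : (∃ t < s, (jointColor hash c₀ d d' (t + 1)).FactorsThrough
      (jointColor hash c₀ d d' t)) ∨
      ∀ {u z : V} {u' z' : W}, gdwlColor hash c₀ d s u = gdwlColor hash c₀ d' s u' →
        gdwlColor hash c₀ d s z = gdwlColor hash c₀ d' s z' → d u z = d' u' z' := by
    obtain _ | t := s
    · right
      intro u z u' z' _ _
      have hV : Subsingleton V :=
        Fintype.card_le_one_iff_subsingleton.1 (show Fintype.card V ≤ 1 from hsV.le)
      have hW : Subsingleton W :=
        Fintype.card_le_one_iff_subsingleton.1 (show Fintype.card W ≤ 1 from (hcardW.trans hsV).le)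
      rw [Subsingleton.elim u z, Subsingleton.elim u' z', hd₀, hd₀']
    · rcases exists_factors_or_le_card (c₀ := c₀) (d := d) (d' := d') hash_injective t
        with ⟨t', ht', hf⟩ | hc
      · exact .inl ⟨t', by omega, hf⟩
      · right
        intro u z u' z' hu hz
        rw [image_jointColor (map_gdwlColor_of_le hash_injective (by omega) hmap)] at hc
        exact dist_eq_of_discrete hash_injective hd hd' hd₀ hd₀' (by rw [hsV]; omega) hinj hinj'
          hu hz
  rcases hlow with ⟨t, ht, hf⟩ | hdist
  · exact stableBelow_of_factors hash_injective (by omega)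
      (map_gdwlColor_of_le hash_injective (by omega) hmap) hf
  refine stableBelow_of_factors hash_injective (Nat.le_succ s) hmap ?_
  have hex : ∀ z : V, ∃ z' : W, gdwlColor hash c₀ d' s z' = gdwlColor hash c₀ d s z := by
    intro z
    have : gdwlColor hash c₀ d s z ∈ Finset.univ.val.map (gdwlColor hash c₀ d s) :=
      Multiset.mem_map_of_mem _ (Finset.mem_univ_val z)
    rw [hmap] at this
    simpa using this
  choose π hπ using hex
  have hbij : Function.Bijective π := (Fintype.bijective_iff_injective_and_card π).2
    ⟨fun a b hab => hinj (by rw [← hπ a, ← hπ b, hab]), hcardW.symm⟩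
  have hstep : ∀ {u : V} {u' : W}, gdwlColor hash c₀ d s u = gdwlColor hash c₀ d' s u' →
      gdwlColor hash c₀ d (s + 1) u = gdwlColor hash c₀ d' (s + 1) u' := by
    intro u u' hu
    rw [gdwlColor_succ, gdwlColor_succ, ← Multiset.map_univ_val_equiv (Equiv.ofBijective π hbij),
      Multiset.map_map]
    congr 2
    funext z
    rw [Function.comp_apply, Equiv.ofBijective_apply, hπ, hdist hu (hπ z).symm]
  rintro (a | a) (b | b) hab
  · rw [hinj hab]
  · exact hstep hab
  · exact (hstep hab.symm).symm
  · rw [hinj' hab]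

end Stabilisation

/-! ### The resistance metric -/

section Resistance

open scoped Classical NNReal

variable {V : Type u} [Fintype V] (G : SimpleGraph V)

/-- The graph Laplacian. -/
noncomputable def lap (f : V → ℝ) (x : V) : ℝ := ∑ y with G.Adj x y, (f x - f y)

/-- `x` and `y` are joined by a walk that avoids `b`. -/
def Linked {V : Type u} (G : SimpleGraph V) (b x y : V) : Prop :=
  ∃ p : G.Walk x y, b ∉ p.support

variable {G}

namespace Linked

variable {V : Type u} {G : SimpleGraph V} {b x y z : V}

lemma refl (h : b ≠ x) : Linked G b x x := ⟨.nil, by simpa using h⟩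

lemma symm (h : Linked G b x y) : Linked G b y x := by
  obtain ⟨p, hp⟩ := h
  exact ⟨p.reverse, by simpa using hp⟩

lemma trans (h : Linked G b x y) (h' : Linked G b y z) : Linked G b x z := by
  obtain ⟨p, hp⟩ := h
  obtain ⟨q, hq⟩ := h'
  exact ⟨p.append q, by simp [SimpleGraph.Walk.mem_support_append_iff, hp, hq]⟩

lemma of_adj (h : G.Adj x y) (hx : b ≠ x) (hy : b ≠ y) : Linked G b x y :=
  ⟨.cons h .nil, by simp [hx, hy]⟩

lemma ne_left (h : Linked G b x y) : b ≠ x := by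
  rintro rfl
  exact h.choose_spec (SimpleGraph.Walk.start_mem_support _)

lemma ne_right (h : Linked G b x y) : b ≠ y := h.symm.ne_left

end Linked

lemma lap_eq_sum_ite (f : V → ℝ) (x : V) :
    lap G f x = ∑ y, if G.Adj x y then f x - f y else 0 := by
  rw [lap, Finset.sum_filter]

lemma lap_add (f g : V → ℝ) (x : V) : lap G (fun z => f z + g z) x = lap G f x + lap G g x := by
  simp only [lap, ← Finset.sum_add_distrib]
  exact Finset.sum_congr rfl fun _ _ => by ring

lemma lap_sub (f g : V → ℝ) (x : V) : lap G (fun z => f z - g z) x = lap G f x - lap G g x := by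
  simp only [lap, ← Finset.sum_sub_distrib]
  exact Finset.sum_congr rfl fun _ _ => by ring

lemma lap_neg (f : V → ℝ) (x : V) : lap G (fun z => -f z) x = -lap G f x := by
  simp only [lap, ← Finset.sum_neg_distrib]
  exact Finset.sum_congr rfl fun _ _ => by ring

lemma lap_smul (c : ℝ) (f : V → ℝ) (x : V) : lap G (fun z => c * f z) x = c * lap G f x := by
  simp only [lap, Finset.mul_sum]
  exact Finset.sum_congr rfl fun _ _ => by ring

lemma sum_mul_lap (f g : V → ℝ) : ∑ x, g x * lap G f x = ∑ x, lap G g x * f x := by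
  have key : ∀ f g : V → ℝ, ∑ x, g x * lap G f x =
      ∑ x, (∑ y, if G.Adj x y then g x * f x else 0) -
        ∑ x, ∑ y, if G.Adj x y then g x * f y else 0 := by
    intro f g
    rw [← Finset.sum_sub_distrib]
    refine Finset.sum_congr rfl fun x _ => ?_
    rw [lap_eq_sum_ite, Finset.mul_sum, ← Finset.sum_sub_distrib]
    refine Finset.sum_congr rfl fun y _ => ?_
    split_ifs <;> ring
  have h2 : ∑ x, lap G g x * f x = ∑ x, f x * lap G g x :=
    Finset.sum_congr rfl fun _ _ => mul_comm _ _
  rw [h2, key f g, key g f]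
  congr 1
  · simp only [mul_comm]
  · rw [Finset.sum_comm]
    refine Finset.sum_congr rfl fun x _ => Finset.sum_congr rfl fun y _ => ?_
    simp only [G.adj_comm y x, mul_comm]

lemma eq_of_adj_of_lap_nonneg {f : V → ℝ} {x : V} (hL : 0 ≤ lap G f x)
    (hmin : ∀ y, G.Adj x y → f x ≤ f y) {y : V} (hy : G.Adj x y) : f y = f x := by
  have h0 : ∀ z ∈ Finset.univ.filter (G.Adj x), f x - f z ≤ 0 := fun z hz => by
    have := hmin z (by simpa using hz)
    linarith
  have h1 : lap G f x = 0 := le_antisymm (Finset.sum_nonpos h0) hL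
  have := (Finset.sum_eq_zero_iff_of_nonpos h0).1 h1 y (by simpa using hy)
  linarith

/-- Minimum principle: a function that is superharmonic off `b` is minimal at `b`. -/
lemma le_of_lap_nonneg {f : V → ℝ} {b : V} (hL : ∀ x, x ≠ b → 0 ≤ lap G f x) {x : V}
    (hx : G.Reachable b x) : f b ≤ f x := by
  obtain ⟨m, hm, hmin⟩ := Finset.exists_min_image (Finset.univ.filter (G.Reachable b)) f
    ⟨b, by simp⟩
  simp only [Finset.mem_filter, Finset.mem_univ, true_and] at hm hmin
  have key : ∀ z c (p : G.Walk z c), c = b → f z = f m → f b = f m := by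
    intro z c p
    induction p with
    | nil => rintro rfl h; exact h
    | @cons z w c h p ih =>
      intro hc hz
      by_cases hzb : z = b
      · rw [← hzb, hz]
      · have hzr : G.Reachable b z := (h.reachable.trans (hc ▸ p.reachable)).symm
        refine ih hc ?_
        rw [eq_of_adj_of_lap_nonneg (hL z hzb) (fun y hy => ?_) h, hz]
        rw [hz]
        exact hmin y (hzr.trans hy.reachable)
  obtain ⟨p⟩ := hm.symm
  rw [key _ _ p rfl rfl]
  exact hmin x hx

/-- Strong minimum principle. -/
lemma eq_of_linked_of_lap_nonneg {f : V → ℝ} {b : V} (hL : ∀ x, x ≠ b → 0 ≤ lap G f x) {x y : V}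
    (hbx : G.Reachable b x) (hx : f x = f b) (hxy : Linked G b x y) : f y = f b := by
  obtain ⟨p, hp⟩ := hxy
  induction p with
  | nil => exact hx
  | @cons z w c h p ih =>
    simp only [SimpleGraph.Walk.support_cons, List.mem_cons, not_or] at hp
    refine ih (hbx.trans h.reachable) ?_ hp.2
    rw [eq_of_adj_of_lap_nonneg (hL z (Ne.symm hp.1)) (fun y hy => ?_) h, hx]
    rw [hx]
    exact le_of_lap_nonneg hL (hbx.trans hy.reachable)

lemma eq_of_lap_eq_zero {f : V → ℝ} (hL : ∀ x, lap G f x = 0) {x y : V}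
    (h : G.Reachable x y) : f x = f y :=
  le_antisymm (le_of_lap_nonneg (fun z _ => (hL z).ge) h)
    (le_of_lap_nonneg (fun z _ => (hL z).ge) h.symm)

lemma isUnitCurrentPotential_iff {a b : V} {φ : V → ℝ} :
    IsUnitCurrentPotential G a b φ ↔
      ∀ x, lap G φ x = (if x = a then 1 else 0) - (if x = b then 1 else 0) := Iff.rfl

variable (G) in
/-- The graph Laplacian as a linear map. -/
noncomputable def lapLin : (V → ℝ) →ₗ[ℝ] (V → ℝ) where
  toFun := lap G
  map_add' f g := funext fun x => lap_add f g x
  map_smul' c f := funext fun x => lap_smul c f x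

lemma exists_isUnitCurrentPotential {a b : V} (h : G.Reachable a b) :
    ∃ φ, IsUnitCurrentPotential G a b φ := by
  set t : V → ℝ := fun x => (if x = a then 1 else 0) - (if x = b then 1 else 0) with ht
  suffices hmem : t ∈ LinearMap.range (lapLin G) by
    obtain ⟨φ, hφ⟩ := hmem
    exact ⟨φ, fun x => congrFun hφ x⟩
  by_contra hmem
  obtain ⟨F, hF, hker⟩ := Submodule.exists_le_ker_of_notMem hmem
  set g : V → ℝ := fun x => F (Pi.single x 1) with hg
  have hFg : ∀ f : V → ℝ, F f = ∑ x, g x * f x := by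
    intro f
    conv_lhs => rw [← Finset.univ_sum_single f, map_sum]
    refine Finset.sum_congr rfl fun x _ => ?_
    have : (Pi.single x (f x) : V → ℝ) = f x • Pi.single x 1 := by
      rw [← Pi.single_smul, smul_eq_mul, mul_one]
    rw [this, map_smul, smul_eq_mul, mul_comm]
  have hlap : ∀ x, lap G g x = 0 := by
    intro x
    have h1 : F (lapLin G (Pi.single x 1)) = 0 := hker ⟨_, rfl⟩
    have h2 : ∑ z, g z * lap G (Pi.single x 1) z = 0 := by rw [← h1, hFg]; rfl
    rw [sum_mul_lap] at h2
    simpa [Pi.single_apply] using h2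
  apply hF
  rw [hFg]
  simp [ht, mul_sub, Finset.sum_sub_distrib, eq_of_lap_eq_zero hlap h]

namespace IsUnitCurrentPotential

variable {a b c d : V} {φ ψ : V → ℝ}

lemma symm (h : IsUnitCurrentPotential G a b φ) :
    IsUnitCurrentPotential G b a (fun x => -φ x) := by
  rw [isUnitCurrentPotential_iff] at h ⊢
  intro x
  rw [lap_neg, h]
  ring

lemma add (h : IsUnitCurrentPotential G a b φ) (h' : IsUnitCurrentPotential G b c ψ) :
    IsUnitCurrentPotential G a c (fun x => φ x + ψ x) := by
  rw [isUnitCurrentPotential_iff] at h h' ⊢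
  intro x
  rw [lap_add, h, h']
  ring

lemma sub_eq_sub (h : IsUnitCurrentPotential G a b φ) (h' : IsUnitCurrentPotential G a b ψ)
    (hab : G.Reachable a b) : φ a - φ b = ψ a - ψ b := by
  rw [isUnitCurrentPotential_iff] at h h'
  have := eq_of_lap_eq_zero (f := fun x => φ x - ψ x) (fun x => by rw [lap_sub, h, h', sub_self])
    hab
  linarith

lemma lap_nonneg (h : IsUnitCurrentPotential G a b φ) (x : V) (hx : x ≠ b) : 0 ≤ lap G φ x := by
  rw [isUnitCurrentPotential_iff] at h
  rw [h, if_neg hx]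
  split_ifs <;> norm_num

lemma lap_neg_nonneg (h : IsUnitCurrentPotential G a b φ) (x : V) (hx : x ≠ a) :
    0 ≤ lap G (fun z => -φ z) x :=
  h.symm.lap_nonneg x hx

lemma le_left (h : IsUnitCurrentPotential G a b φ) {x : V} (hx : G.Reachable a x) :
    φ x ≤ φ a := by
  have := le_of_lap_nonneg h.lap_neg_nonneg hx
  linarith

lemma right_le (h : IsUnitCurrentPotential G a b φ) {x : V} (hx : G.Reachable b x) :
    φ b ≤ φ x := le_of_lap_nonneg h.lap_nonneg hx

lemma reciprocity (h : IsUnitCurrentPotential G a b φ) (h' : IsUnitCurrentPotential G c d ψ) :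
    ψ a - ψ b = φ c - φ d := by
  have := sum_mul_lap (G := G) φ ψ
  rw [isUnitCurrentPotential_iff] at h h'
  simpa [h, h', mul_sub, sub_mul, Finset.sum_sub_distrib] using this

lemma right_lt_left (h : IsUnitCurrentPotential G a b φ) (hab : G.Reachable a b) (hne : a ≠ b) :
    φ b < φ a := by
  refine lt_of_le_of_ne (h.right_le hab.symm) fun heq => ?_
  have h1 : lap G φ a = 1 := by rw [isUnitCurrentPotential_iff.1 h]; simp [hne]
  have h2 : lap G φ a ≤ 0 := Finset.sum_nonpos fun y hy => by
    have := h.right_le (hab.symm.trans (SimpleGraph.Adj.reachable (by simpa using hy)))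
    linarith
  linarith

/-- The potential at `c` equals that at the sink `b` iff `b` separates `c` from the source `a`. -/
lemma eq_right_iff (h : IsUnitCurrentPotential G a b φ) (hab : G.Reachable a b) (hne : a ≠ b)
    (hbc : G.Reachable b c) : φ c = φ b ↔ ¬ Linked G b a c := by
  constructor
  · intro heq hl
    have := eq_of_linked_of_lap_nonneg h.lap_nonneg hbc heq hl.symm
    exact (h.right_lt_left hab hne).ne' this
  · intro hl
    set f : V → ℝ := fun x => if Linked G b c x then -φ x else -φ b with hf
    have hlap : ∀ x, x ≠ b → 0 ≤ lap G f x := by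
      intro x hx
      by_cases hcx : Linked G b c x
      · have hxa : x ≠ a := by rintro rfl; exact hl hcx.symm
        have : lap G f x = lap G (fun z => -φ z) x := by
          refine Finset.sum_congr rfl fun y hy => ?_
          have hxy : G.Adj x y := by simpa using hy
          have hfy : f y = -φ y := by
            by_cases hyb : y = b
            · simp [hf, hyb]
            · simp only [hf]
              rw [if_pos (hcx.trans (Linked.of_adj hxy hx.symm (Ne.symm hyb)))]
          rw [hfy]
          simp [hf, hcx]
        rw [this]
        exact h.lap_neg_nonneg x hxa
      · refine Finset.sum_nonneg fun y hy => ?_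
        have hxy : G.Adj x y := by simpa using hy
        have hcy : ¬ Linked G b c y := fun hcy =>
          hcx (hcy.trans (Linked.of_adj hxy.symm hcy.ne_right hx.symm))
        simp [hf, hcx, hcy]
    have h1 := le_of_lap_nonneg hlap hbc
    have h2 : f b = -φ b := by simp [hf]
    have h3 : f c ≤ -φ c := by
      by_cases hcc : Linked G b c c
      · simp [hf, hcc]
      · have : b = c := by
          by_contra hbc
          exact hcc (Linked.refl hbc)
        subst this
        simp [hf]
    exact le_antisymm (by linarith) (h.right_le hbc)

end IsUnitCurrentPotential

lemma resistanceDist_eq {a b : V} {φ : V → ℝ} (h : IsUnitCurrentPotential G a b φ)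
    (hab : G.Reachable a b) : resistanceDist G a b = ENNReal.ofReal (φ a - φ b) := by
  refine le_antisymm (iInf₂_le φ h) (le_iInf₂ fun ψ hψ => ?_)
  rw [h.sub_eq_sub hψ hab]

/-- The finite resistance value recorded by a pair of distances, `0` if the distance is `∞`. -/
noncomputable def resValue (d : ℕ∞ × ℝ≥0∞) : ℝ≥0 := if d.1 = ⊤ then 0 else d.2.toNNReal

variable (G) in
/-- The resistance distance as a real number, `0` between different components. -/
noncomputable def res (a b : V) : ℝ := resValue (spdRd G a b)

lemma edist_eq_top_iff {V : Type u} {G : SimpleGraph V} {a b : V} : G.edist a b = ⊤ ↔ ¬ G.Reachable a b :=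
  ⟨fun h hr => by
    obtain ⟨p, hp⟩ := hr.exists_walk_length_eq_edist
    exact ENat.natCast_ne_top p.length (hp.trans h),
  SimpleGraph.edist_eq_top_of_not_reachable⟩

lemma res_eq {a b : V} {φ : V → ℝ} (h : IsUnitCurrentPotential G a b φ)
    (hab : G.Reachable a b) : res G a b = φ a - φ b := by
  have h1 : ¬ G.edist a b = ⊤ := by rw [edist_eq_top_iff, not_not]; exact hab
  rw [res, resValue, spdRd, if_neg h1, resistanceDist_eq h hab]
  exact Real.coe_toNNReal _ (sub_nonneg.2 (h.right_le hab.symm))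

lemma res_nonneg (a b : V) : 0 ≤ res G a b := NNReal.coe_nonneg _

lemma res_of_not_reachable {a b : V} (h : ¬ G.Reachable a b) : res G a b = 0 := by
  rw [res, resValue, spdRd, if_pos (edist_eq_top_iff.2 h), NNReal.coe_zero]

@[simp] lemma res_self (a : V) : res G a a = 0 := by
  obtain ⟨φ, hφ⟩ := exists_isUnitCurrentPotential (SimpleGraph.Reachable.refl (G := G) a)
  rw [res_eq hφ (.refl a), sub_self]

lemma resistanceDist_comm (a b : V) : resistanceDist G a b = resistanceDist G b a := by
  have key : ∀ a b : V, resistanceDist G a b ≤ resistanceDist G b a := fun a b =>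
    le_iInf₂ fun φ hφ => (iInf₂_le _ hφ.symm).trans (le_of_eq (by congr 1; ring))
  exact le_antisymm (key a b) (key b a)

lemma spdRd_comm (a b : V) : spdRd G a b = spdRd G b a := by
  rw [spdRd, spdRd, SimpleGraph.edist_comm, resistanceDist_comm]

lemma spdRd_self (a : V) : spdRd G a a = (0, 0) := by
  obtain ⟨φ, hφ⟩ := exists_isUnitCurrentPotential (SimpleGraph.Reachable.refl (G := G) a)
  rw [spdRd, SimpleGraph.edist_self, resistanceDist_eq hφ (.refl a), sub_self, ENNReal.ofReal_zero]

lemma res_comm (a b : V) : res G a b = res G b a := by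
  rw [res, res, spdRd_comm]

lemma res_pos {a b : V} (h : G.Reachable a b) (hne : a ≠ b) : 0 < res G a b := by
  obtain ⟨φ, hφ⟩ := exists_isUnitCurrentPotential h
  rw [res_eq hφ h]
  linarith [hφ.right_lt_left h hne]

lemma res_triangle_defect {a b c : V} (hab : G.Reachable a b) (hbc : G.Reachable b c) :
    ∃ φ, IsUnitCurrentPotential G a b φ ∧
      res G a c = res G a b + res G b c - 2 * (φ c - φ b) := by
  obtain ⟨φ, hφ⟩ := exists_isUnitCurrentPotential hab
  obtain ⟨ψ, hψ⟩ := exists_isUnitCurrentPotential hbc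
  refine ⟨φ, hφ, ?_⟩
  rw [res_eq hφ hab, res_eq hψ hbc, res_eq (hφ.add hψ) (hab.trans hbc)]
  have := hφ.reciprocity hψ
  linarith

lemma res_triangle {a b c : V} (hab : G.Reachable a b) (hbc : G.Reachable b c) :
    res G a c ≤ res G a b + res G b c := by
  obtain ⟨φ, hφ, h⟩ := res_triangle_defect hab hbc
  have := hφ.right_le hbc
  linarith

lemma res_add_res_eq_iff {a b c : V} (hab : G.Reachable a b) (hbc : G.Reachable b c)
    (hne : a ≠ b) : res G a c = res G a b + res G b c ↔ ¬ Linked G b a c := by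
  obtain ⟨φ, hφ, h⟩ := res_triangle_defect hab hbc
  rw [← hφ.eq_right_iff hab hne hbc]
  constructor <;> intro <;> linarith

lemma res_eq_one_iff {a b : V} (h : G.Adj a b) : res G a b = 1 ↔ G.IsBridge s(a, b) := by
  rw [SimpleGraph.isBridge_iff]
  constructor
  · intro h1
    obtain ⟨φ, hφ⟩ := exists_isUnitCurrentPotential h.reachable
    rw [res_eq hφ h.reachable] at h1
    have key : ∀ x c (p : (G.deleteEdges {s(a, b)}).Walk x c), G.Reachable a x → φ x = φ a →
        φ c = φ a := by
      intro x c p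
      induction p with
      | nil => exact fun _ h => h
      | @cons x y c hxy p ih =>
        intro hr hx
        rw [SimpleGraph.deleteEdges_adj] at hxy
        refine ih (hr.trans hxy.1.reachable) ?_
        by_cases hxa : x = a
        · subst hxa
          have hyb : y ≠ b := by rintro rfl; exact hxy.2 rfl
          have hlap : lap G φ x = 1 := by rw [isUnitCurrentPotential_iff.1 hφ]; simp [h.ne]
          rw [lap, ← Finset.add_sum_erase _ _ (by simpa using h : b ∈ Finset.univ.filter (G.Adj x)),
            h1, add_eq_left] at hlap
          have h0 : ∀ z ∈ (Finset.univ.filter (G.Adj x)).erase b, 0 ≤ φ x - φ z := by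
            intro z hz
            simp only [Finset.mem_erase, Finset.mem_filter, Finset.mem_univ, true_and] at hz
            linarith [hφ.le_left hz.2.reachable]
          have := (Finset.sum_eq_zero_iff_of_nonneg h0).1 hlap y (by simp [hyb, hxy.1])
          linarith
        · have := eq_of_adj_of_lap_nonneg (f := fun z => -φ z) (hφ.lap_neg_nonneg x hxa)
            (fun z hz => by rw [hx, neg_le_neg_iff]; exact hφ.le_left (hr.trans hz.reachable)) hxy.1
          linarith
    rintro ⟨p⟩
    have := key _ _ p (.refl a) rfl
    linarith
  · intro hb
    set D := G.deleteEdges {s(a, b)} with hD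
    set φ : V → ℝ := fun x => if D.Reachable a x then 1 else 0 with hφ
    have hne : ∀ x y, G.Adj x y → s(x, y) ≠ s(a, b) → φ x = φ y := by
      intro x y hxy hs
      have hDxy : D.Adj x y := by rw [hD, SimpleGraph.deleteEdges_adj]; exact ⟨hxy, hs⟩
      have : D.Reachable a x ↔ D.Reachable a y :=
        ⟨fun h => h.trans hDxy.reachable, fun h => h.trans hDxy.symm.reachable⟩
      simp only [hφ, this]
    have ha : φ a = 1 := by simp [hφ]
    have hb' : φ b = 0 := by simp [hφ, hb]
    have hpot : IsUnitCurrentPotential G a b φ := by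
      rw [isUnitCurrentPotential_iff]
      intro x
      by_cases hxa : x = a
      · subst hxa
        rw [lap, Finset.sum_eq_single_of_mem b (by simpa using h)]
        · simp [ha, hb', h.ne]
        · intro y hy hyb
          rw [hne x y (by simpa using hy) (by
            rw [Ne, Sym2.eq_iff]
            rintro (⟨-, h'⟩ | ⟨h', -⟩)
            exacts [hyb h', h.ne h']), sub_self]
      · by_cases hxb : x = b
        · subst hxb
          rw [lap, Finset.sum_eq_single_of_mem a (by simpa using h.symm)]
          · simp [ha, hb', h.ne']
          · intro y hy hya
            rw [hne x y (by simpa using hy) (by simp [h.ne', hya]), sub_self]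
        · rw [lap, Finset.sum_eq_zero]
          · simp [hxa, hxb]
          · intro y hy
            rw [hne x y (by simpa using hy) (by simp [hxa, hxb]), sub_self]
    rw [res_eq hpot h.reachable, ha, hb', sub_zero]

end Resistance

/-! ### Cut vertices, bridges and biconnected components -/

section Graph

open SimpleGraph

variable {V : Type u} {G : SimpleGraph V}

lemma exists_walk_of_walk_induce {S : Set V} {x y : S} (p : (G.induce S).Walk x y) :
    ∃ q : G.Walk x y, ∀ z ∈ q.support, ∃ h : z ∈ S, ⟨z, h⟩ ∈ p.support := by
  refine ⟨p.map (Embedding.induce _).toHom, fun z hz => ?_⟩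
  have h := Walk.support_map (Embedding.induce S).toHom p
  obtain ⟨w, hw, rfl⟩ := List.mem_map.1 ((congrArg (z ∈ ·) h).mp hz)
  exact ⟨w.2, hw⟩

lemma card_lt_of_surjective_of_not_injective {α β : Type*} [Finite α] {f : α → β}
    (hf : Function.Surjective f) (h : ¬ Function.Injective f) : Nat.card β < Nat.card α :=
  lt_of_not_ge fun h' => h (hf.bijective_of_nat_card_le h').1

lemma induce_compl_reachable_iff {v : V} {x y : ({v}ᶜ : Set V)} :
    (G.induce ({v}ᶜ : Set V)).Reachable x y ↔ Linked G v x y := by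
  constructor
  · rintro ⟨p⟩
    obtain ⟨q, hq⟩ := exists_walk_of_walk_induce p
    exact ⟨q, fun hv => (hq v hv).1 rfl⟩
  · rintro ⟨p, hp⟩
    exact ⟨p.induce _ fun z hz => by rintro rfl; exact hp hz⟩

lemma isCutVertex_iff_linked [Finite V] {v : V} :
    IsCutVertex G v ↔ ∃ x y, x ≠ v ∧ y ≠ v ∧ G.Reachable x y ∧ ¬ Linked G v x y := by
  set f : (G.induce ({v}ᶜ : Set V)).ConnectedComponent → G.ConnectedComponent :=
    ConnectedComponent.map (Embedding.induce _).toHom with hf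
  have hinj : ¬ Function.Injective f ↔
      ∃ x y, x ≠ v ∧ y ≠ v ∧ G.Reachable x y ∧ ¬ Linked G v x y := by
    constructor
    · intro h
      simp only [Function.Injective, not_forall] at h
      obtain ⟨C, C', h, hne⟩ := h
      induction C using ConnectedComponent.ind with | _ x
      induction C' using ConnectedComponent.ind with | _ y
      refine ⟨x, y, x.2, y.2, ConnectedComponent.exact h, fun hl => hne ?_⟩
      exact ConnectedComponent.sound (induce_compl_reachable_iff.2 hl)
    · rintro ⟨x, y, hx, hy, hr, hl⟩ h
      have := @h ((G.induce ({v}ᶜ : Set V)).connectedComponentMk ⟨x, hx⟩)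
        ((G.induce ({v}ᶜ : Set V)).connectedComponentMk ⟨y, hy⟩) (ConnectedComponent.sound hr)
      exact hl (induce_compl_reachable_iff.1 (ConnectedComponent.exact this))
  rw [← hinj, IsCutVertex]
  constructor
  · intro h h'
    exact h.not_ge (Nat.card_le_card_of_injective f h')
  · intro h
    refine card_lt_of_surjective_of_not_injective (f := f) (fun C => ?_) h
    obtain ⟨x, y, hx, hy, hr, hl⟩ := hinj.1 h
    induction C using ConnectedComponent.ind with | _ z
    by_cases hz : z = v
    · refine ⟨(G.induce ({v}ᶜ : Set V)).connectedComponentMk ⟨x, hx⟩,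
        ConnectedComponent.sound (G := G) (v := x) (w := z) ?_⟩
      obtain ⟨p⟩ := hr
      have : v ∈ p.support := by
        by_contra hv
        exact hl ⟨p, hv⟩
      subst hz
      classical
      exact ⟨p.takeUntil z this⟩
    · exact ⟨(G.induce ({v}ᶜ : Set V)).connectedComponentMk ⟨z, hz⟩, rfl⟩

lemma reachable_deleteEdges_of_reachable {a b x y : V}
    (hab : G.Adj a b → (G.deleteEdges {s(a, b)}).Reachable a b) (h : G.Reachable x y) :
    (G.deleteEdges {s(a, b)}).Reachable x y := by
  obtain ⟨p⟩ := h
  induction p with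
  | nil => exact .rfl
  | @cons x z y hxz p ih =>
    refine Reachable.trans ?_ ih
    by_cases he : s(x, z) = s(a, b)
    · rcases Sym2.eq_iff.1 he with ⟨rfl, rfl⟩ | ⟨rfl, rfl⟩
      · exact hab hxz
      · exact (hab hxz.symm).symm
    · exact Adj.reachable (by rw [deleteEdges_adj]; exact ⟨hxz, he⟩)

lemma isCutEdge_iff [Finite V] {e : Sym2 V} : IsCutEdge G e ↔ e ∈ G.edgeSet ∧ G.IsBridge e := by
  rw [IsCutEdge, and_congr_right_iff]
  intro he
  induction e using Sym2.ind with | _ a b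
  rw [isBridge_iff]
  set f : (G.deleteEdges {s(a, b)}).ConnectedComponent → G.ConnectedComponent :=
    ConnectedComponent.map (Hom.ofLE (G.deleteEdges_le _)) with hf
  have hsurj : Function.Surjective f := fun C => by
    induction C using ConnectedComponent.ind with | _ z
    exact ⟨connectedComponentMk _ z, rfl⟩
  have hinj : Function.Injective f ↔ (G.deleteEdges {s(a, b)}).Reachable a b := by
    constructor
    · intro h
      exact ConnectedComponent.exact (@h (connectedComponentMk _ a) (connectedComponentMk _ b)
        (ConnectedComponent.sound (Adj.reachable he)))
    · intro h C C' hC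
      induction C using ConnectedComponent.ind with | _ x
      induction C' using ConnectedComponent.ind with | _ y
      exact ConnectedComponent.sound
        (reachable_deleteEdges_of_reachable (fun _ => h) (ConnectedComponent.exact hC))
  rw [← hinj]
  constructor
  · intro h h'
    exact h.not_ge (Nat.card_le_card_of_injective f h')
  · exact card_lt_of_surjective_of_not_injective hsurj

/-- `x` and `y` are connected and not separated by any third vertex. -/
def Inseparable (G : SimpleGraph V) (x y : V) : Prop :=
  G.Reachable x y ∧ ∀ v, v ≠ x → v ≠ y → Linked G v x y

lemma Inseparable.refl (x : V) : Inseparable G x x :=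
  ⟨.rfl, fun _ h _ => Linked.refl h⟩

lemma Inseparable.symm {x y : V} (h : Inseparable G x y) : Inseparable G y x :=
  ⟨h.1.symm, fun v hy hx => (h.2 v hx hy).symm⟩

lemma vertexBiconnected_iff [Finite V] : VertexBiconnected G ↔
    Nonempty V ∧ ∀ x y, Inseparable G x y := by
  constructor
  · rintro ⟨hc, hv⟩
    refine ⟨hc.nonempty, fun x y => ⟨hc.preconnected x y, fun v hx hy => ?_⟩⟩
    by_contra hl
    exact hv v (isCutVertex_iff_linked.2 ⟨x, y, hx.symm, hy.symm, hc.preconnected x y, hl⟩)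
  · rintro ⟨hne, h⟩
    refine ⟨⟨fun x y => (h x y).1⟩, fun v hv => ?_⟩
    obtain ⟨x, y, hx, hy, -, hl⟩ := isCutVertex_iff_linked.1 hv
    exact hl ((h x y).2 v hx.symm hy.symm)

lemma Inseparable.of_induce {S : Set V} {x y : S} (h : Inseparable (G.induce S) x y) :
    Inseparable G x y := by
  refine ⟨h.1.map (Embedding.induce _).toHom, fun v hx hy => ?_⟩
  by_cases hv : v ∈ S
  · obtain ⟨p, hp⟩ := h.2 ⟨v, hv⟩ (by rintro rfl; exact hx rfl) (by rintro rfl; exact hy rfl)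
    obtain ⟨q, hq⟩ := exists_walk_of_walk_induce p
    exact ⟨q, fun h' => hp (hq v h').2⟩
  · obtain ⟨p⟩ := h.1
    obtain ⟨q, hq⟩ := exists_walk_of_walk_induce p
    exact ⟨q, fun h' => hv (hq v h').1⟩

lemma mem_of_mem_support_of_maximal {S : Set V} (hS : ∀ x ∈ S, ∀ y ∈ S, Inseparable G x y)
    (hmax : ∀ z, (∀ x ∈ S, Inseparable G z x) → z ∈ S) {x y : V} (hx : x ∈ S) (hy : y ∈ S)
    {p : G.Walk x y} (hp : p.IsPath) {z : V} (hz : z ∈ p.support) : z ∈ S := by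
  classical
  refine hmax z fun s hs => ⟨?_, fun w hwz hws => ?_⟩
  · exact (p.takeUntil z hz).reachable.symm.trans (hS x hx s hs).1
  · by_cases hw : w ∈ (p.takeUntil z hz).support
    · have hw' : w ∉ (p.dropUntil z hz).support := fun hw' => by
        have h1 := hp.support_nodup
        rw [← Walk.take_spec p hz, Walk.support_append] at h1
        refine List.disjoint_of_nodup_append h1 hw ?_
        rw [← Walk.cons_tail_support, List.mem_cons] at hw'
        exact hw'.resolve_left hwz
      have hl : Linked G w z y := ⟨_, hw'⟩
      exact hl.trans ((hS y hy s hs).2 w hl.ne_right hws)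
    · have hl : Linked G w x z := ⟨_, hw⟩
      exact hl.symm.trans ((hS x hx s hs).2 w hl.ne_left hws)

lemma vertexBiconnected_induce_of_maximal [Finite V] {S : Set V} (hne : S.Nonempty)
    (hS : ∀ x ∈ S, ∀ y ∈ S, Inseparable G x y)
    (hmax : ∀ z, (∀ x ∈ S, Inseparable G z x) → z ∈ S) : VertexBiconnected (G.induce S) := by
  classical
  rw [vertexBiconnected_iff]
  refine ⟨hne.to_subtype, fun x y => ⟨?_, fun v hx hy => ?_⟩⟩
  · obtain ⟨p, hp⟩ := (hS x x.2 y y.2).1.exists_isPath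
    exact ⟨p.induce S fun z hz => mem_of_mem_support_of_maximal hS hmax x.2 y.2 hp hz⟩
  · obtain ⟨p, hp⟩ := (hS x x.2 y y.2).2 v (fun h => hx (Subtype.ext h))
      (fun h => hy (Subtype.ext h))
    refine ⟨p.bypass.induce S fun z hz =>
      mem_of_mem_support_of_maximal hS hmax x.2 y.2 p.bypass_isPath hz, fun hv => hp ?_⟩
    rw [Walk.support_induce, List.mem_attachWith] at hv
    exact Walk.support_bypass_subset_support p hv

lemma isVertexBCC_iff [Finite V] {S : Set V} : IsVertexBCC G S ↔ S.Nonempty ∧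
    (∀ x ∈ S, ∀ y ∈ S, Inseparable G x y) ∧ ∀ z, (∀ x ∈ S, Inseparable G z x) → z ∈ S := by
  have hcl : ∀ T : Set V, VertexBiconnected (G.induce T) →
      T.Nonempty ∧ ∀ x ∈ T, ∀ y ∈ T, Inseparable G x y := by
    intro T hT
    obtain ⟨hne, h⟩ := vertexBiconnected_iff.1 hT
    exact ⟨Set.nonempty_coe_sort.1 hne, fun x hx y hy => (h ⟨x, hx⟩ ⟨y, hy⟩).of_induce⟩
  constructor
  · rintro ⟨hb, hm⟩
    obtain ⟨hne, hS⟩ := hcl S hb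
    refine ⟨hne, hS, ?_⟩
    obtain ⟨T, hST, hT⟩ := (Set.toFinite
      {T : Set V | ∀ x ∈ T, ∀ y ∈ T, Inseparable G x y}).exists_le_maximal hS
    have hTmax : ∀ z, (∀ x ∈ T, Inseparable G z x) → z ∈ T := by
      intro z hz
      refine hT.2 (y := insert z T) ?_ (Set.subset_insert _ _) (Set.mem_insert _ _)
      rintro x (rfl | hx) y (rfl | hy)
      exacts [Inseparable.refl _, hz y hy, (hz x hx).symm, hT.1 x hx y hy]
    have hTb := vertexBiconnected_induce_of_maximal (hne.mono hST) hT.1 hTmax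
    rcases eq_or_ssubset_of_subset hST with rfl | hlt
    · exact hTmax
    · exact absurd hTb (hm T hlt)
  · rintro ⟨hne, hS, hmax⟩
    refine ⟨vertexBiconnected_induce_of_maximal hne hS hmax, fun T hT hb => ?_⟩
    obtain ⟨z, hzT, hzS⟩ := Set.exists_of_ssubset hT
    exact hzS (hmax z fun x hx => (hcl T hb).2 z hzT x (hT.1 hx))

lemma edgeBiconnected_iff [Finite V] : EdgeBiconnected G ↔
    G.Connected ∧ ∀ x y, G.Adj x y → (G.deleteEdges {s(x, y)}).Reachable x y := by
  rw [EdgeBiconnected, and_congr_right_iff]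
  intro _
  constructor
  · intro h x y hxy
    by_contra hr
    exact h s(x, y) (isCutEdge_iff.2 ⟨hxy, hr⟩)
  · intro h e he
    induction e using Sym2.ind with | _ x y
    obtain ⟨hxy, hb⟩ := isCutEdge_iff.1 he
    exact hb (h x y hxy)

lemma isEdgeReachable_two_of_edgeBiconnected [Finite V] {S : Set V}
    (h : EdgeBiconnected (G.induce S)) {x y : V} (hx : x ∈ S) (hy : y ∈ S) :
    G.IsEdgeReachable 2 x y := by
  obtain ⟨hc, he⟩ := edgeBiconnected_iff.1 h
  rw [isEdgeReachable_two]
  intro e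
  obtain ⟨p⟩ := hc.preconnected ⟨x, hx⟩ ⟨y, hy⟩
  suffices key : ∀ a b (p : (G.induce S).Walk a b), (G.deleteEdges {e}).Reachable a.1 b.1 from
    key _ _ p
  intro a b p
  induction p with
  | nil => exact .rfl
  | @cons a c b hac p ih =>
    refine Reachable.trans ?_ ih
    by_cases hs : s(a.1, c.1) = e
    · refine (he a c hac).map ⟨Subtype.val, @fun i j hij => ?_⟩
      rw [deleteEdges_adj] at hij ⊢
      refine ⟨hij.1, fun h' => hij.2 ?_⟩
      rw [Set.mem_singleton_iff, ← hs, Sym2.eq_iff] at h'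
      rw [Set.mem_singleton_iff, Sym2.eq_iff]
      simpa only [Subtype.ext_iff] using h'
    · exact Adj.reachable (by rw [deleteEdges_adj]; exact ⟨hac, hs⟩)

lemma edgeBiconnected_induce_class [Finite V] (x : V) :
    EdgeBiconnected (G.induce {y | G.IsEdgeReachable 2 x y}) := by
  classical
  have hmem : ∀ y z : {y | G.IsEdgeReachable 2 x y}, ∀ p : G.Walk y.1 z.1, p.IsPath →
      ∀ w ∈ p.support, w ∈ {y | G.IsEdgeReachable 2 x y} := fun y z p hp w hw =>
    y.2.trans (hp.isTrail.isEdgeReachable_two_of_isEdgeReachable_two (y.2.symm.trans z.2)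
      p.start_mem_support hw)
  rw [edgeBiconnected_iff]
  have : Nonempty {y | G.IsEdgeReachable 2 x y} := ⟨⟨x, IsEdgeReachable.rfl⟩⟩
  refine ⟨⟨fun y z => ?_⟩, fun y z _ => ?_⟩
  · have hyz := y.2.symm.trans z.2
    obtain ⟨p, hp⟩ := (hyz.reachable two_ne_zero).exists_isPath
    exact ⟨p.induce _ (hmem y z p hp)⟩
  · have hyz := isEdgeReachable_two.1 (y.2.symm.trans z.2) s(y.1, z.1)
    obtain ⟨p, hp⟩ := reachable_deleteEdges_iff_exists_walk.1 hyz
    rw [reachable_deleteEdges_iff_exists_walk]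
    refine ⟨p.bypass.induce _ (hmem y z _ p.bypass_isPath), fun h => hp ?_⟩
    have h2 := List.mem_map_of_mem (f := Sym2.map Subtype.val) h
    refine p.edges_bypass_subset_edges ?_
    have h3 := congrArg Walk.edges
      (Walk.map_induce p.bypass (hmem y z _ p.bypass_isPath))
    exact (congrArg (s(y.1, z.1) ∈ ·) (h3.symm.trans (Walk.edges_map _ _))).mpr h2

lemma isEdgeBCC_iff [Finite V] {S : Set V} :
    IsEdgeBCC G S ↔ ∃ x, S = {y | G.IsEdgeReachable 2 x y} := by
  constructor
  · rintro ⟨hb, hm⟩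
    obtain ⟨⟨x, hx⟩⟩ := hb.1.nonempty
    have hsub : S ⊆ {y | G.IsEdgeReachable 2 x y} := fun y hy =>
      isEdgeReachable_two_of_edgeBiconnected hb hx hy
    refine ⟨x, ?_⟩
    rcases eq_or_ssubset_of_subset hsub with h | hlt
    · exact h
    · exact absurd (edgeBiconnected_induce_class x) (hm _ hlt)
  · rintro ⟨x, rfl⟩
    refine ⟨edgeBiconnected_induce_class x, fun T hT hb => ?_⟩
    obtain ⟨z, hzT, hz⟩ := Set.exists_of_ssubset hT
    exact hz (isEdgeReachable_two_of_edgeBiconnected hb (hT.1 IsEdgeReachable.rfl) hzT)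

end Graph

/-! ### Separation and eccentricity in the resistance metric -/

section Geometry

open scoped NNReal

variable {V : Type u} [Fintype V] (G : SimpleGraph V)

/-- The largest resistance distance from `a` to a vertex of its connected component. -/
noncomputable def ecc (a : V) : ℝ := (Finset.univ.sup fun b => resValue (spdRd G a b) : ℝ≥0)

/-- `v` separates `x` from `y`, expressed by the resistance distance. -/
def Btw (v x y : V) : Prop :=
  x ≠ v ∧ y ≠ v ∧ G.Reachable v x ∧ G.Reachable v y ∧ res G x y = res G x v + res G v y

/-- `v` is a proper ancestor of `x`: it separates `x` from the vertices farthest from `v`. -/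
def Anc (v x : V) : Prop := x ≠ v ∧ G.Reachable v x ∧ ecc G x = ecc G v + res G v x

/-- `p` is the closest ancestor of `x`. -/
def Par (p x : V) : Prop := Anc G p x ∧ ∀ u, Anc G u x → ecc G u ≤ ecc G p

/-- `x` and `y` have the same closest ancestor (if any), and lie in the same block with it. -/
def Mate (x y : V) : Prop :=
  G.Reachable x y ∧
    ((∀ u, ¬ Anc G u x) ∧ (∀ u, ¬ Anc G u y) ∨ ∃ p, Par G p x ∧ Par G p y ∧ ¬ Btw G p x y)

/-- The vertices in the block of `x` and its closest ancestor. -/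
def upperBlock (x : V) : Set V := {y | Mate G x y ∨ Par G y x}

/-- `x` has an ancestor, or shares its topmost block with another vertex, or is isolated. -/
def HasUpperBlock (x : V) : Prop :=
  (∃ p, Par G p x) ∨ (∃ y, y ≠ x ∧ Mate G x y) ∨ ecc G x = 0

variable {G} {a b c p q u v w x y z : V}

lemma res_le_ecc (a b : V) : res G a b ≤ ecc G a :=
  NNReal.coe_le_coe.2 (Finset.le_sup (f := fun b => resValue (spdRd G a b)) (Finset.mem_univ b))

lemma ecc_nonneg (a : V) : 0 ≤ ecc G a := NNReal.coe_nonneg _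

lemma exists_res_eq_ecc (a : V) : ∃ b, G.Reachable a b ∧ res G a b = ecc G a := by
  obtain ⟨b, -, hb⟩ := Finset.exists_mem_eq_sup Finset.univ ⟨a, Finset.mem_univ a⟩
    (fun b => resValue (spdRd G a b))
  have hb' : ecc G a = res G a b := congrArg NNReal.toReal hb
  by_cases h : G.Reachable a b
  · exact ⟨b, h, hb'.symm⟩
  · exact ⟨a, .rfl, by rw [hb', res_self, res_of_not_reachable h]⟩

lemma ecc_le (h : G.Reachable a b) : ecc G a ≤ res G a b + ecc G b := by
  obtain ⟨z, hz, hz'⟩ := exists_res_eq_ecc (G := G) a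
  have := res_triangle h (h.symm.trans hz)
  linarith [res_le_ecc (G := G) b z]

lemma btw_iff (hx : x ≠ v) (hy : y ≠ v) (hvx : G.Reachable v x) (hvy : G.Reachable v y) :
    Btw G v x y ↔ ¬ Linked G v x y := by
  rw [← res_add_res_eq_iff hvx.symm hvy hx, Btw]
  exact ⟨fun h => h.2.2.2.2, fun h => ⟨hx, hy, hvx, hvy, h⟩⟩

lemma Btw.symm (h : Btw G v x y) : Btw G v y x := by
  obtain ⟨h1, h2, h3, h4, h5⟩ := h
  refine ⟨h2, h1, h4, h3, ?_⟩
  rw [res_comm y x, h5, res_comm v y, res_comm x v, add_comm]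

lemma not_btw_self (v x : V) : ¬ Btw G v x x := by
  rintro ⟨h1, -, h2, -, h3⟩
  rw [res_self, res_comm v x] at h3
  linarith [res_pos h2.symm h1]

/-- Not being separated by `v` is transitive. -/
lemma Btw.or (h : Btw G v x y) (hz : z ≠ v) (hvz : G.Reachable v z) :
    Btw G v x z ∨ Btw G v z y := by
  obtain ⟨hx, hy, hvx, hvy, -⟩ := id h
  rw [btw_iff hx hy hvx hvy] at h
  rw [btw_iff hx hz hvx hvz, btw_iff hz hy hvz hvy, ← not_and_or]
  exact fun h' => h (h'.1.trans h'.2)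

lemma reachable_or_linked {V : Type u} {G : SimpleGraph V} {v x y : V} (h : G.Reachable x y) :
    G.Reachable v x ∨ Linked G v x y := by
  classical
  obtain ⟨p⟩ := h
  by_cases hv : v ∈ p.support
  · exact .inl (p.takeUntil v hv).reachable.symm
  · exact .inr ⟨p, hv⟩

lemma inseparable_iff : Inseparable G x y ↔ G.Reachable x y ∧ ∀ v, ¬ Btw G v x y := by
  refine and_congr_right fun hr => forall_congr' fun v => ?_
  constructor
  · intro h hb
    exact (btw_iff hb.1 hb.2.1 hb.2.2.1 hb.2.2.2.1).1 hb (h hb.1.symm hb.2.1.symm)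
  · intro h hx hy
    by_contra hl
    have hvx : G.Reachable v x := (reachable_or_linked hr).resolve_right hl
    exact h ((btw_iff hx.symm hy.symm hvx (hvx.trans hr)).2 hl)

lemma isCutVertex_iff_btw : IsCutVertex G v ↔ ∃ x y, Btw G v x y := by
  rw [isCutVertex_iff_linked]
  refine exists_congr fun x => exists_congr fun y => ?_
  constructor
  · rintro ⟨hx, hy, hr, hl⟩
    have hvx : G.Reachable v x := (reachable_or_linked hr).resolve_right hl
    exact (btw_iff hx hy hvx (hvx.trans hr)).2 hl
  · intro hb
    exact ⟨hb.1, hb.2.1, hb.2.2.1.symm.trans hb.2.2.2.1,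
      (btw_iff hb.1 hb.2.1 hb.2.2.1 hb.2.2.2.1).1 hb⟩

namespace Anc

lemma ecc_lt (h : Anc G v x) : ecc G v < ecc G x := by
  linarith [res_pos h.2.1 h.1.symm, h.2.2]

lemma res_eq (h : Anc G v x) : res G x v = ecc G x - ecc G v := by
  rw [res_comm]
  linarith [h.2.2]

lemma trans (h : Anc G u v) (h' : Anc G v x) : Anc G u x := by
  refine ⟨?_, h.2.1.trans h'.2.1, ?_⟩
  · rintro rfl
    linarith [h.ecc_lt, h'.ecc_lt]
  · have h1 := res_triangle h.2.1 h'.2.1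
    have h2 := ecc_le (h.2.1.trans h'.2.1).symm
    rw [res_comm] at h2
    linarith [h.2.2, h'.2.2]

lemma exists_btw (h : Anc G v x) : ∃ y, Btw G v x y ∧ res G v y = ecc G v := by
  obtain ⟨hne, hr, he⟩ := h
  obtain ⟨y, hy, hy'⟩ := exists_res_eq_ecc (G := G) x
  have h1 := res_triangle hr.symm (hr.trans hy)
  have h2 := res_le_ecc (G := G) v y
  have h3 := res_comm (G := G) x v
  have h4 : y ≠ v := by
    rintro rfl
    rw [res_self] at h1
    have := res_pos hr hne.symm
    have := res_le_ecc (G := G) y x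
    linarith
  exact ⟨y, ⟨hne, h4, hr, hr.trans hy, by linarith⟩, by linarith⟩

lemma of_btw (h : Btw G v x y) (hy : res G v y = ecc G v) : Anc G v x := by
  obtain ⟨hne, -, hr, hr', he⟩ := h
  have h1 := ecc_le hr.symm
  have h2 := res_le_ecc (G := G) x y
  have h3 := res_comm (G := G) x v
  exact ⟨hne, hr, by linarith⟩

/-- A vertex that is not a descendant of `v` is separated by `v` from all descendants. -/
lemma btw_or (h : Anc G v x) (hz : z ≠ v) (hvz : G.Reachable v z) : Btw G v x z ∨ Anc G v z := by
  obtain ⟨y, hy, hy'⟩ := h.exists_btw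
  exact (hy.or hz hvz).imp id fun h' => of_btw h' hy'

lemma or_anc (h : Anc G v x) (h' : Anc G u x) (hne : u ≠ v) : Anc G v u ∨ Anc G u v := by
  have hvu := h.2.1.trans h'.2.1.symm
  rcases h.btw_or hne hvu with h1 | h1
  · rcases h'.btw_or hne.symm hvu.symm with h2 | h2
    · have := h1.2.2.2.2
      have := h2.2.2.2.2
      have := res_comm (G := G) u v
      linarith [res_pos hvu hne.symm]
    · exact .inr h2
  · exact .inl h1

lemma eq_of_ecc_eq (h : Anc G v x) (h' : Anc G u x) (he : ecc G u = ecc G v) : u = v := by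
  by_contra hne
  rcases h.or_anc h' hne with h1 | h1 <;> linarith [h1.ecc_lt]

lemma not_btw (h : Anc G v p) (h' : Anc G p x) : ¬ Btw G v x p := by
  intro hb
  have h1 := (h.trans h').2.2
  have := hb.2.2.2.2
  have := res_comm (G := G) x p
  have := res_comm (G := G) x v
  linarith [h.2.2, h'.2.2, res_pos h.2.1 h.1.symm]

end Anc

lemma Btw.anc_or (h : Btw G v x y) : Anc G v x ∨ Anc G v y := by
  obtain ⟨z, hz, hz'⟩ := exists_res_eq_ecc (G := G) v
  have hzv : z ≠ v := by
    rintro rfl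
    rw [res_self] at hz'
    linarith [res_le_ecc (G := G) z x, res_pos h.2.2.1 h.1.symm]
  rcases h.or hzv hz with h1 | h1
  · exact .inl (.of_btw h1 hz')
  · exact .inr (.of_btw h1.symm hz')

lemma isCutVertex_iff_anc : IsCutVertex G v ↔ ∃ x, Anc G v x := by
  rw [isCutVertex_iff_btw]
  constructor
  · rintro ⟨x, y, h⟩
    exact h.anc_or.elim (fun h => ⟨x, h⟩) fun h => ⟨y, h⟩
  · rintro ⟨x, h⟩
    obtain ⟨y, hy, -⟩ := h.exists_btw
    exact ⟨x, y, hy⟩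

lemma Anc.exists_par (h : Anc G v x) : ∃ p, Par G p x := by
  classical
  obtain ⟨p, hp, hmax⟩ := Finset.exists_max_image (Finset.univ.filter (Anc G · x)) (ecc G)
    ⟨v, by simpa using h⟩
  simp only [Finset.mem_filter, Finset.mem_univ, true_and] at hp hmax
  exact ⟨p, hp, hmax⟩

namespace Par

lemma unique (h : Par G p x) (h' : Par G q x) : p = q :=
  h'.1.eq_of_ecc_eq h.1 (le_antisymm (h'.2 p h.1) (h.2 q h'.1))

lemma anc_of_anc (h : Par G p x) (hv : Anc G v x) (hne : v ≠ p) : Anc G v p := by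
  rcases hv.or_anc h.1 hne.symm with h1 | h1
  · exact h1
  · exact absurd (h.2 v hv) (not_le.2 h1.ecc_lt)

lemma inseparable (h : Par G p x) : Inseparable G x p := by
  refine inseparable_iff.2 ⟨h.1.2.1.symm, fun v hb => ?_⟩
  have hv : Anc G v p := by
    rcases hb.anc_or with h1 | h1
    · exact h.anc_of_anc h1 hb.2.1.symm
    · exact h1
  exact hv.not_btw h.1 hb

end Par

namespace Mate

lemma refl (x : V) : Mate G x x := by
  refine ⟨.rfl, ?_⟩
  by_cases h : ∃ u, Anc G u x
  · obtain ⟨u, hu⟩ := h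
    obtain ⟨p, hp⟩ := hu.exists_par
    exact .inr ⟨p, hp, hp, not_btw_self p x⟩
  · push Not at h
    exact .inl ⟨h, h⟩

lemma symm (h : Mate G x y) : Mate G y x :=
  ⟨h.1.symm, h.2.imp And.symm fun ⟨p, h1, h2, h3⟩ => ⟨p, h2, h1, fun h => h3 h.symm⟩⟩

lemma par (h : Mate G x y) (hp : Par G p x) : Par G p y := by
  rcases h.2 with h | ⟨q, h1, h2, -⟩
  · exact absurd hp.1 (h.1 p)
  · rwa [hp.unique h1]

lemma not_btw (h : Mate G x y) (hp : Par G p x) : ¬ Btw G p x y := by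
  rcases h.2 with h | ⟨q, h1, -, h3⟩
  · exact absurd hp.1 (h.1 p)
  · rwa [hp.unique h1]

lemma trans (h : Mate G x y) (h' : Mate G y z) : Mate G x z := by
  refine ⟨h.1.trans h'.1, ?_⟩
  rcases h.2 with ⟨h1, h2⟩ | ⟨p, h1, h2, h3⟩
  · rcases h'.2 with ⟨-, h4⟩ | ⟨p, h4, -⟩
    · exact .inl ⟨h1, h4⟩
    · exact absurd h4.1 (h2 p)
  · refine .inr ⟨p, h1, h'.par h2, fun hb => ?_⟩
    exact (hb.or h2.1.1 h2.1.2.1).elim h3 (h'.not_btw h2)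

lemma inseparable (h : Mate G x y) : Inseparable G x y := by
  have key : ∀ {v x y}, Mate G x y → Btw G v x y → ¬ Anc G v x := by
    intro v x y h hb hv
    obtain ⟨p, hp⟩ := hv.exists_par
    by_cases hvp : v = p
    · subst hvp
      exact h.not_btw hp hb
    · have hvp' := hp.anc_of_anc hv hvp
      have hpy := h.par hp
      rcases hb.or (Ne.symm hvp) hvp'.2.1 with h1 | h1
      · exact hvp'.not_btw hp.1 h1
      · exact hvp'.not_btw hpy.1 h1.symm
  exact inseparable_iff.2 ⟨h.1, fun v hb => hb.anc_or.elim (key h hb) (key h.symm hb.symm)⟩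

end Mate

lemma Inseparable.anc_of_anc (h : Inseparable G x y) (hv : Anc G v x) (hne : v ≠ y) :
    Anc G v y :=
  (hv.btw_or hne.symm (hv.2.1.trans h.1)).resolve_left ((inseparable_iff.1 h).2 v)

lemma Inseparable.mate_or (h : Inseparable G x y) : Mate G x y ∨ Par G y x ∨ Par G x y := by
  have key : ∀ {x y}, Inseparable G x y → Anc G y x → Par G y x := by
    intro x y h hy
    obtain ⟨p, hp⟩ := hy.exists_par
    by_cases hpy : p = y
    · rwa [← hpy]
    · have h1 := h.anc_of_anc hp.1 hpy
      linarith [h1.ecc_lt, hp.2 y hy]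
  by_cases hy : Anc G y x
  · exact .inr (.inl (key h hy))
  by_cases hx : Anc G x y
  · exact .inr (.inr (key h.symm hx))
  refine .inl ⟨h.1, ?_⟩
  have h1 : ∀ v, Anc G v x → Anc G v y := fun v hv =>
    h.anc_of_anc hv (by rintro rfl; exact hy hv)
  have h2 : ∀ v, Anc G v y → Anc G v x := fun v hv =>
    h.symm.anc_of_anc hv (by rintro rfl; exact hx hv)
  by_cases he : ∃ u, Anc G u x
  · obtain ⟨u, hu⟩ := he
    obtain ⟨p, hp⟩ := hu.exists_par
    exact .inr ⟨p, hp, ⟨h1 p hp.1, fun u hu => hp.2 u (h2 u hu)⟩, (inseparable_iff.1 h).2 p⟩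
  · push Not at he
    exact .inl ⟨he, fun u hu => he u (h2 u hu)⟩

lemma mem_upperBlock_self (x : V) : x ∈ upperBlock G x := .inl (.refl x)

lemma inseparable_of_mem_upperBlock (hy : y ∈ upperBlock G x) (hz : z ∈ upperBlock G x) :
    Inseparable G y z := by
  rcases hy with hy | hy
  · rcases hz with hz | hz
    · exact (hy.symm.trans hz).inseparable
    · exact (hy.par hz).inseparable
  · rcases hz with hz | hz
    · exact (hz.par hy).inseparable.symm
    · rw [hy.unique hz]
      exact .refl _

lemma isVertexBCC_upperBlock (h : HasUpperBlock G x) : IsVertexBCC G (upperBlock G x) := by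
  rw [isVertexBCC_iff]
  refine ⟨⟨x, mem_upperBlock_self x⟩,
    fun y hy z hz => inseparable_of_mem_upperBlock hy hz, fun w hw => ?_⟩
  rcases (hw x (mem_upperBlock_self x)).mate_or with h1 | h1 | h1
  · exact .inl h1.symm
  · exfalso
    rcases h with ⟨p, hp⟩ | ⟨y, hyx, hy⟩ | h
    · have h2 := (hw p (.inr hp)).anc_of_anc h1.1 hp.1.1
      linarith [h2.ecc_lt, hp.1.ecc_lt]
    · have h2 := (hw y (.inl hy)).anc_of_anc h1.1 (Ne.symm hyx)
      obtain ⟨p, hp⟩ := h2.exists_par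
      have h4 := hy.symm.par hp
      have h6 : Anc G x x := by
        by_cases hxp : x = p
        · rw [← hxp] at h4
          exact h4.1
        · exact (hp.anc_of_anc h2 hxp).trans h4.1
      exact h6.1 rfl
    · linarith [res_le_ecc (G := G) x w, res_pos h1.1.2.1 h1.1.1.symm]
  · exact .inr h1

lemma eq_upperBlock_of_isVertexBCC {S : Set V} (h : IsVertexBCC G S) :
    ∃ x, HasUpperBlock G x ∧ S = upperBlock G x := by
  classical
  rw [isVertexBCC_iff] at h
  obtain ⟨hne, hS, hmax⟩ := h
  obtain ⟨x, hx, hxmax⟩ := Set.exists_max_image S (ecc G) S.toFinite hne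
  have hsub : S ⊆ upperBlock G x := fun y hy => by
    rcases (hS x hx y hy).mate_or with h1 | h1 | h1
    · exact .inl h1
    · exact .inr h1
    · linarith [hxmax y hy, h1.1.ecc_lt]
  have heq : S = upperBlock G x := hsub.antisymm fun y hy =>
    hmax y fun z hz => inseparable_of_mem_upperBlock hy (hsub hz)
  refine ⟨x, ?_, heq⟩
  by_contra hp
  simp only [HasUpperBlock, not_or, not_exists, not_and] at hp
  obtain ⟨h1, h2, h3⟩ := hp
  obtain ⟨b, hb, hb'⟩ := exists_res_eq_ecc (G := G) x
  have hbx : b ≠ x := by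
    rintro rfl
    rw [res_self] at hb'
    exact h3 hb'.symm
  obtain ⟨y, hy, hymin⟩ := Finset.exists_min_image
    (Finset.univ.filter fun y => y ≠ x ∧ G.Reachable x y) (res G x) ⟨b, by simp [hbx, hb]⟩
  simp only [Finset.mem_filter, Finset.mem_univ, true_and] at hy hymin
  have hyx : Inseparable G y x := by
    refine inseparable_iff.2 ⟨hy.2.symm, fun v hv => ?_⟩
    have h4 := hymin v ⟨hv.2.1.symm, hv.2.2.2.1.symm⟩
    have h5 := hv.2.2.2.2
    rw [res_comm y x, res_comm v x] at h5
    linarith [res_pos hv.2.2.1.symm hv.1]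
  have hmem : y ∈ S := hmax y fun z hz => by
    rcases hsub hz with h | h
    · by_cases hzx : z = x
      · rwa [hzx]
      · exact absurd h (h2 z hzx)
    · exact absurd h (h1 z)
  rcases hsub hmem with h | h
  · exact h2 y hy.1 h
  · exact h1 y h

lemma upperBlock_eq_iff : upperBlock G x = upperBlock G y ↔ Mate G x y := by
  constructor
  · intro h
    have h1 : x ∈ upperBlock G y := h ▸ mem_upperBlock_self x
    have h2 : y ∈ upperBlock G x := h ▸ mem_upperBlock_self y
    rcases h1 with h1 | h1
    · exact h1.symm
    rcases h2 with h2 | h2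
    · exact h2
    · linarith [h1.1.ecc_lt, h2.1.ecc_lt]
  · intro h
    ext z
    exact or_congr ⟨h.symm.trans, h.trans⟩ ⟨h.par, h.symm.par⟩

lemma Mate.hasUpperBlock (h : Mate G x y) (hx : HasUpperBlock G x) : HasUpperBlock G y := by
  by_cases hxy : x = y
  · rwa [← hxy]
  · exact .inr (.inl ⟨x, hxy, h.symm⟩)

/-- Vertices of the same upper block can be recognised by eccentricities and distances. -/
lemma mate_iff : Mate G x y ↔ G.Reachable x y ∧
    ((∀ u, ¬ Anc G u x) ∧ (∀ u, ¬ Anc G u y) ∨ ∃ p q, Par G p x ∧ Par G q y ∧ ecc G p = ecc G q ∧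
      res G x y < (ecc G x - ecc G p) + (ecc G y - ecc G q)) := by
  refine and_congr_right fun hr => or_congr_right ?_
  constructor
  · rintro ⟨p, h1, h2, h3⟩
    refine ⟨p, p, h1, h2, rfl, lt_of_le_of_ne ?_ fun he => h3 ⟨h1.1.1, h2.1.1, h1.1.2.1,
      h2.1.2.1, ?_⟩⟩
    · rw [← h1.1.res_eq, ← h2.1.res_eq, res_comm y p]
      exact res_triangle h1.1.2.1.symm h2.1.2.1
    · rw [he, ← h1.1.res_eq, ← h2.1.res_eq, res_comm y p]
  · rintro ⟨p, q, hp, hq, he, hlt⟩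
    have hpq : p = q := by
      by_contra hne
      have hnpq : ¬ Anc G p q := fun h => by linarith [h.ecc_lt]
      have hnqp : ¬ Anc G q p := fun h => by linarith [h.ecc_lt]
      have hpy : ¬ Anc G p y := fun h => (h.or_anc hq.1 (Ne.symm hne)).elim hnpq hnqp
      have hyp : y ≠ p := by
        rintro rfl
        exact hnqp hq.1
      have h1 := (hp.1.btw_or hyp (hp.1.2.1.trans hr)).resolve_right hpy
      have hpq' : G.Reachable p q := (hp.1.2.1.trans hr).trans hq.1.2.1.symm
      have h2 := (hq.1.btw_or hne hpq'.symm).resolve_right hnqp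
      have h3 := h1.2.2.2.2
      have h4 := h2.2.2.2.2
      rw [hp.1.res_eq] at h3
      rw [res_comm p y, h4, hq.1.res_eq] at h3
      linarith [res_pos hpq'.symm (Ne.symm hne)]
    subst hpq
    refine ⟨p, hp, hq, fun hb => ?_⟩
    have h3 := hb.2.2.2.2
    rw [res_comm p y, hp.1.res_eq, hq.1.res_eq] at h3
    linarith

end Geometry

/-! ### Bridges in the resistance metric -/

section Bridges

open SimpleGraph

variable {V : Type u} [Fintype V] (G : SimpleGraph V)

/-- `p` and `t` are joined by a bridge. -/
def Br (p t : V) : Prop := G.Adj p t ∧ res G p t = 1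

/-- `t` has a bridge such that the vertices farthest from `t` lie on the other side. -/
def LocalRoot (t : V) : Prop := ∃ p, Br G p t ∧ ecc G p < ecc G t + 1

/-- `x` lies on the side of `t` of the bridge that makes `t` a local root. -/
def EdgeAnc (t x : V) : Prop := LocalRoot G t ∧ G.Reachable t x ∧ ecc G x = ecc G t + res G t x

/-- `t` is the closest local root above `x`. -/
def Top (t x : V) : Prop := EdgeAnc G t x ∧ ∀ u, EdgeAnc G u x → ecc G u ≤ ecc G t

variable {G} {p q t u x y z p' q' : V}

namespace Br

lemma symm (h : Br G p t) : Br G t p := ⟨h.1.symm, by rw [res_comm, h.2]⟩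

lemma side_or (h : Br G p t) (hx : G.Reachable p x) :
    (G.deleteEdges {s(p, t)}).Reachable t x ∨ (G.deleteEdges {s(p, t)}).Reachable p x := by
  obtain ⟨w⟩ := hx.symm
  induction w with
  | nil => exact .inr .rfl
  | @cons a b c hab w ih =>
    by_cases he : s(a, b) = s(c, t)
    · rcases Sym2.eq_iff.1 he with ⟨rfl, -⟩ | ⟨rfl, -⟩
      · exact .inr .rfl
      · exact .inl .rfl
    · have hr : (G.deleteEdges {s(c, t)}).Reachable b a :=
        Adj.reachable (by rw [deleteEdges_adj]; exact ⟨hab.symm, fun h' => he (Sym2.eq_swap.trans h')⟩)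
      exact (ih h w.reverse.reachable).imp (·.trans hr) (·.trans hr)

lemma res_eq_of_reachable (h : Br G p t) (hx : (G.deleteEdges {s(p, t)}).Reachable t x) :
    res G p x = 1 + res G t x := by
  rw [← h.2, res_add_res_eq_iff h.1.reachable (hx.mono (deleteEdges_le _)) h.1.ne]
  rintro ⟨w, hw⟩
  refine (isBridge_iff.1 ((res_eq_one_iff h.1).1 h.2)) (Reachable.trans ?_ hx.symm)
  exact reachable_deleteEdges_iff_exists_walk.2 ⟨w, fun hm => hw (w.snd_mem_support_of_mem_edges hm)⟩

lemma cases (h : Br G p t) (hx : G.Reachable p x) :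
    res G p x = 1 + res G t x ∨ res G t x = 1 + res G p x :=
  (h.side_or hx).imp h.res_eq_of_reachable fun h' =>
    h.symm.res_eq_of_reachable (by rwa [Sym2.eq_swap])

lemma side_iff (h : Br G p t) (hx : G.Reachable p x) :
    res G p x = 1 + res G t x ↔ (G.deleteEdges {s(p, t)}).Reachable t x := by
  refine ⟨fun he => (h.side_or hx).resolve_right fun h' => ?_, h.res_eq_of_reachable⟩
  have := h.symm.res_eq_of_reachable (x := x) (by rwa [Sym2.eq_swap])
  linarith

lemma res_eq_add (h : Br G p t) (hx : G.Reachable p x) (hz : G.Reachable p z)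
    (hxt : res G p x = 1 + res G t x) (hzp : res G t z = 1 + res G p z) :
    res G x z = res G t x + 1 + res G p z := by
  by_cases hx' : x = t
  · subst hx'
    rw [res_self, hzp, zero_add]
  · have hpt := h.1.reachable.symm
    have hb : Btw G t p x := ⟨h.1.ne, hx', hpt, hpt.trans hx, by rw [hxt, h.2]⟩
    have hzt : z ≠ t := by
      rintro rfl
      rw [res_self] at hzp
      linarith [res_nonneg (G := G) p z]
    rcases hb.or hzt (hpt.trans hz) with h1 | h1
    · have := h1.2.2.2.2
      rw [h.2] at this
      linarith
    · have := h1.symm.2.2.2.2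
      rw [res_comm x t, hzp] at this
      linarith

lemma ecc_side_iff (h : Br G p t) (hlt : ecc G p < ecc G t + 1) (hx : G.Reachable p x) :
    res G p x = 1 + res G t x ↔ ecc G x = ecc G t + res G t x := by
  have hpt := h.1.reachable
  constructor
  · intro hs
    obtain ⟨z, hz, hz'⟩ := exists_res_eq_ecc (G := G) t
    have hzp : res G t z = 1 + res G p z := by
      refine (h.cases (hpt.trans hz)).resolve_left fun h' => ?_
      linarith [res_le_ecc (G := G) p z]
    have h1 := h.res_eq_add hx (hpt.trans hz) hs hzp
    have h2 := res_le_ecc (G := G) x z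
    have h3 := ecc_le (hx.symm.trans hpt)
    rw [res_comm] at h3
    linarith
  · intro he
    refine (h.cases hx).resolve_right fun h' => ?_
    have h3 := ecc_le hx.symm
    rw [res_comm] at h3
    linarith

lemma edgeAnc_iff (h : Br G p t) (hlt : ecc G p < ecc G t + 1) (hx : G.Reachable p x) :
    res G p x = 1 + res G t x ↔ EdgeAnc G t x := by
  rw [h.ecc_side_iff hlt hx]
  exact ⟨fun he => ⟨⟨p, h, hlt⟩, h.1.reachable.symm.trans hx, he⟩, fun h => h.2.2⟩

end Br

lemma isEdgeReachable_two_iff : G.IsEdgeReachable 2 x y ↔ G.Reachable x y ∧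
    ∀ p t, Br G p t → G.Reachable p x → res G p x = 1 + res G t x → res G p y = 1 + res G t y := by
  constructor
  · intro h
    refine ⟨h.reachable two_ne_zero, fun p t hb hx he => ?_⟩
    rw [hb.side_iff hx] at he
    exact hb.res_eq_of_reachable (he.trans (isEdgeReachable_two.1 h _))
  · rintro ⟨hr, h⟩
    rw [isEdgeReachable_two]
    intro e
    induction e using Sym2.ind with | _ p t
    by_cases hb : G.Adj p t ∧ ¬ (G.deleteEdges {s(p, t)}).Reachable p t
    · obtain ⟨hadj, hb⟩ := hb
      have hBr : Br G p t := ⟨hadj, (res_eq_one_iff hadj).2 hb⟩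
      by_cases hx : G.Reachable p x
      · rcases hBr.cases hx with h1 | h1
        · have h2 := h p t hBr hx h1
          rw [hBr.side_iff hx] at h1
          rw [hBr.side_iff (hx.trans hr)] at h2
          exact h1.symm.trans h2
        · have hx' := hadj.symm.reachable.trans hx
          have h2 := h t p hBr.symm hx' h1
          rw [hBr.symm.side_iff hx', Sym2.eq_swap] at h1
          rw [hBr.symm.side_iff (hx'.trans hr), Sym2.eq_swap] at h2
          exact h1.symm.trans h2
      · obtain ⟨w⟩ := hr
        refine reachable_deleteEdges_iff_exists_walk.2 ⟨w, fun hm => hx ?_⟩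
        classical
        exact (w.takeUntil p (w.fst_mem_support_of_mem_edges hm)).reachable.symm
    · exact reachable_deleteEdges_of_reachable
        (fun hadj => by_contra fun hn => hb ⟨hadj, hn⟩) hr

lemma br_iff_not_isEdgeReachable_two (h : G.Adj x y) : Br G x y ↔ ¬ G.IsEdgeReachable 2 x y := by
  rw [← isBridge_iff_not_isEdgeReachable_two h, ← res_eq_one_iff h, Br, and_iff_right h]

namespace EdgeAnc

lemma ecc_lt (h : EdgeAnc G t x) (hne : t ≠ x) : ecc G t < ecc G x := by
  linarith [h.2.2, res_pos h.2.1 hne]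

lemma ecc_le (h : EdgeAnc G t x) : ecc G t ≤ ecc G x := by
  linarith [h.2.2, res_nonneg (G := G) t x]

lemma res_eq (h : EdgeAnc G t x) : res G x t = ecc G x - ecc G t := by
  rw [res_comm]
  linarith [h.2.2]

lemma trans (h : EdgeAnc G u t) (h' : EdgeAnc G t x) : EdgeAnc G u x := by
  refine ⟨h.1, h.2.1.trans h'.2.1, ?_⟩
  have h1 := res_triangle h.2.1 h'.2.1
  have h2 := GDWL.ecc_le (h.2.1.trans h'.2.1).symm
  rw [res_comm] at h2
  linarith [h.2.2, h'.2.2]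

/-- A local root lies between its descendants and its non-descendants. -/
lemma res_eq_add (h : EdgeAnc G t x) (hz : ¬ EdgeAnc G t z) (hr : G.Reachable t z) :
    res G x z = res G x t + res G t z := by
  obtain ⟨p, hp, hlt⟩ := h.1
  have hpt := hp.1.reachable
  have hx := (hp.edgeAnc_iff hlt (hpt.trans h.2.1)).2 h
  rw [← hp.edgeAnc_iff hlt (hpt.trans hr)] at hz
  have hz' := (hp.cases (hpt.trans hr)).resolve_left hz
  rw [hp.res_eq_add (hpt.trans h.2.1) (hpt.trans hr) hx hz', hz', res_comm x t]
  ring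

lemma or_anc (h : EdgeAnc G t x) (h' : EdgeAnc G u x) : EdgeAnc G t u ∨ EdgeAnc G u t := by
  by_contra hn
  rw [not_or] at hn
  have hr := h.2.1.trans h'.2.1.symm
  have h1 := h.res_eq_add hn.1 hr
  have h2 := h'.res_eq_add hn.2 hr.symm
  have h3 := res_comm (G := G) t u
  by_cases htu : t = u
  · subst htu
    exact hn.1 ⟨h.1, .rfl, by rw [res_self, add_zero]⟩
  · linarith [res_pos hr htu]

lemma eq_of_ecc_eq (h : EdgeAnc G t x) (h' : EdgeAnc G u x) (he : ecc G t = ecc G u) : t = u := by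
  by_contra hne
  rcases h.or_anc h' with h1 | h1
  · linarith [h1.ecc_lt hne]
  · linarith [h1.ecc_lt (Ne.symm hne)]

lemma exists_top (h : EdgeAnc G t x) : ∃ s, Top G s x := by
  classical
  obtain ⟨p, hp, hmax⟩ := Finset.exists_max_image (Finset.univ.filter (EdgeAnc G · x)) (ecc G)
    ⟨t, by simpa using h⟩
  simp only [Finset.mem_filter, Finset.mem_univ, true_and] at hp hmax
  exact ⟨p, hp, hmax⟩

end EdgeAnc

namespace Top

lemma unique (h : Top G t x) (h' : Top G u x) : t = u :=
  h.1.eq_of_ecc_eq h'.1 (le_antisymm (h'.2 t h.1) (h.2 u h'.1))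

lemma edgeAnc_iff (h : Top G t x) : EdgeAnc G u x ↔ EdgeAnc G u t := by
  refine ⟨fun hu => ?_, fun hu => hu.trans h.1⟩
  rcases hu.or_anc h.1 with h1 | h1
  · exact h1
  · have := (h.1.eq_of_ecc_eq hu (le_antisymm h1.ecc_le (h.2 u hu)))
    rwa [← this] at h1 ⊢

end Top

lemma isEdgeReachable_two_iff_edgeAnc : G.IsEdgeReachable 2 x y ↔
    G.Reachable x y ∧ ∀ t, EdgeAnc G t x ↔ EdgeAnc G t y := by
  have key : ∀ {x y}, G.IsEdgeReachable 2 x y → ∀ t, EdgeAnc G t x → EdgeAnc G t y := by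
    rintro x y h t ⟨⟨p, hp, hlt⟩, hx⟩
    have hpx := hp.1.reachable.trans hx.1
    obtain ⟨hr, h⟩ := isEdgeReachable_two_iff.1 h
    exact (hp.edgeAnc_iff hlt (hpx.trans hr)).1
      (h p t hp hpx ((hp.edgeAnc_iff hlt hpx).2 ⟨⟨p, hp, hlt⟩, hx⟩))
  constructor
  · exact fun h => ⟨h.reachable two_ne_zero, fun t => ⟨key h t, key h.symm t⟩⟩
  · rintro ⟨hr, h⟩
    refine isEdgeReachable_two_iff.2 ⟨hr, fun p t hb hx hs => ?_⟩
    by_cases hlt : ecc G p < ecc G t + 1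
    · rw [hb.edgeAnc_iff hlt hx] at hs
      rw [hb.edgeAnc_iff hlt (hx.trans hr), ← h t]
      exact hs
    · have hlt' : ecc G t < ecc G p + 1 := by linarith
      have htx := hb.1.symm.reachable.trans hx
      refine (hb.cases (hx.trans hr)).resolve_right fun h' => ?_
      rw [hb.symm.edgeAnc_iff hlt' (htx.trans hr), ← h p, ← hb.symm.edgeAnc_iff hlt' htx] at h'
      linarith

lemma Top.of_isEdgeReachable_two (h : Top G t x) (hxy : G.IsEdgeReachable 2 x y) : Top G t y := by
  have h' := (isEdgeReachable_two_iff_edgeAnc.1 hxy).2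
  exact ⟨(h' t).1 h.1, fun u hu => h.2 u ((h' u).2 hu)⟩

/-- Two-edge-reachable vertices can be recognised by eccentricities and distances. -/
lemma isEdgeReachable_two_iff_top : G.IsEdgeReachable 2 x y ↔ G.Reachable x y ∧
    ((∀ u, ¬ EdgeAnc G u x) ∧ (∀ u, ¬ EdgeAnc G u y) ∨ ∃ s t, Top G s x ∧ Top G t y ∧
      ecc G s = ecc G t ∧ res G x y ≤ (ecc G x - ecc G s) + (ecc G y - ecc G t)) := by
  constructor
  · intro h
    obtain ⟨hr, h'⟩ := isEdgeReachable_two_iff_edgeAnc.1 h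
    refine ⟨hr, ?_⟩
    by_cases hx : ∃ u, EdgeAnc G u x
    · obtain ⟨u, hu⟩ := hx
      obtain ⟨s, hs⟩ := hu.exists_top
      have hsy := hs.of_isEdgeReachable_two h
      refine .inr ⟨s, s, hs, hsy, rfl, ?_⟩
      rw [← hs.1.res_eq, ← hsy.1.res_eq, res_comm y s]
      exact res_triangle hs.1.2.1.symm hsy.1.2.1
    · push Not at hx
      exact .inl ⟨hx, fun u hu => hx u ((h' u).2 hu)⟩
  · rintro ⟨hr, h | ⟨s, t, hs, ht, he, hle⟩⟩
    · exact isEdgeReachable_two_iff_edgeAnc.2 ⟨hr, fun t => iff_of_false (h.1 t) (h.2 t)⟩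
    · have hst : s = t := by
        by_contra hne
        have hnst : ¬ EdgeAnc G s t := fun h => by linarith [h.ecc_lt hne]
        have hnts : ¬ EdgeAnc G t s := fun h => by linarith [h.ecc_lt (Ne.symm hne)]
        have hsy : ¬ EdgeAnc G s y := fun h => (h.or_anc ht.1).elim hnst hnts
        have hsy' := hs.1.2.1.trans hr
        have hst' := hsy'.trans ht.1.2.1.symm
        have h1 := hs.1.res_eq_add hsy hsy'
        have h2 := ht.1.res_eq_add hnts hst'.symm
        rw [hs.1.res_eq] at h1
        rw [ht.1.res_eq, res_comm] at h2
        linarith [res_pos hst'.symm (Ne.symm hne)]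
      subst hst
      exact isEdgeReachable_two_iff_edgeAnc.2
        ⟨hr, fun u => by rw [hs.edgeAnc_iff, ht.edgeAnc_iff]⟩

/-- There is at most one bridge between two classes. -/
lemma Br.eq_of_isEdgeReachable_two (h : Br G p q) (h' : Br G p' q')
    (hp : G.IsEdgeReachable 2 p p') (hq : G.IsEdgeReachable 2 q q') : p = p' ∧ q = q' := by
  have hpq := h.1.reachable
  have h1 := (isEdgeReachable_two_iff.1 hp).2 q p h.symm hpq.symm
    (by rw [h.symm.2, res_self, add_zero])
  have h2 := (isEdgeReachable_two_iff.1 hq).2 p q h hpq (by rw [h.2, res_self, add_zero])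
  have hpp := hp.reachable two_ne_zero
  have hqq := hq.reachable two_ne_zero
  have h3 := h.res_eq_add (hpq.trans hqq) hpp h2 h1
  rw [h'.symm.2] at h3
  have h4 := res_nonneg (G := G) p p'
  have h5 := res_nonneg (G := G) q q'
  constructor
  · by_contra hne
    linarith [res_pos hpp hne]
  · by_contra hne
    linarith [res_pos hqq hne]

lemma Br.top (h : Br G p q) (hlt : ecc G p < ecc G q + 1) : Top G q q :=
  ⟨⟨⟨p, h, hlt⟩, .rfl, by rw [res_self, add_zero]⟩, fun _ hu => hu.ecc_le⟩

lemma Br.eq_of_ecc_lt (h : Br G p q) (h' : Br G p' q) (hlt : ecc G p < ecc G q + 1)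
    (hlt' : ecc G p' < ecc G q + 1) : p = p' := by
  by_contra hne
  have key : ∀ {p p'}, Br G p q → Br G p' q → ecc G p' < ecc G q + 1 → p ≠ p' →
      EdgeAnc G q p := by
    intro p p' h h' hlt' hne
    have hpp := h'.1.reachable.trans h.1.symm.reachable
    rw [← h'.edgeAnc_iff hlt' hpp]
    refine (h'.cases hpp).resolve_right fun hn => ?_
    rw [h.symm.2] at hn
    linarith [res_pos hpp hne.symm]
  have h1 := key h h' hlt' hne
  have h2 := h1.2.2
  rw [h.symm.2] at h2
  linarith

open Classical in
variable (G) in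
/-- The eccentricity of the closest local root, or `-1`. -/
noncomputable def topRank (x : V) : ℝ := if h : ∃ t, Top G t x then ecc G h.choose else -1

lemma Top.topRank_eq (h : Top G t x) : topRank G x = ecc G t := by
  have hex : ∃ t, Top G t x := ⟨t, h⟩
  rw [topRank, dif_pos hex, hex.choose_spec.unique h]

lemma topRank_le_ecc (x : V) : topRank G x ≤ ecc G x := by
  rw [topRank]
  split_ifs with h
  · exact h.choose_spec.1.ecc_le
  · linarith [ecc_nonneg (G := G) x]

lemma topRank_eq_of_isEdgeReachable_two (h : G.IsEdgeReachable 2 x y) :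
    topRank G x = topRank G y := by
  by_cases hx : ∃ t, Top G t x
  · obtain ⟨t, ht⟩ := hx
    rw [ht.topRank_eq, (ht.of_isEdgeReachable_two h).topRank_eq]
  · have hy : ¬ ∃ t, Top G t y := fun ⟨t, ht⟩ => hx ⟨t, ht.of_isEdgeReachable_two h.symm⟩
    rw [topRank, dif_neg hx, topRank, dif_neg hy]

lemma Br.ecc_lt_of_topRank_le (h : Br G p q) (hle : topRank G p ≤ topRank G q) :
    ecc G p < ecc G q + 1 := by
  by_contra hlt
  have h1 := (h.symm.top (by linarith)).topRank_eq
  linarith [topRank_le_ecc (G := G) q]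

/-- A class has at most one neighbouring class of the same or lower rank. -/
lemma Br.isEdgeReachable_two_of_topRank_le (h : Br G p q) (h' : Br G p' q')
    (hq : G.IsEdgeReachable 2 q q') (hle : topRank G p ≤ topRank G q)
    (hle' : topRank G p' ≤ topRank G q') : p = p' := by
  have hlt := h.ecc_lt_of_topRank_le hle
  have hlt' := h'.ecc_lt_of_topRank_le hle'
  have hqq := ((h.top hlt).of_isEdgeReachable_two hq).unique (h'.top hlt')
  subst hqq
  exact h.eq_of_ecc_lt h' hlt hlt'

/-- In a nonempty finite set of vertices, not every vertex has both a neighbour in the set along a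
bridge and a neighbour in the set along an edge that is not a bridge. -/
lemma eq_empty_of_forall_exists_br (Q : Set V) (hB : ∀ x ∈ Q, ∃ y ∈ Q, Br G x y)
    (hN : ∀ x ∈ Q, ∃ y ∈ Q, G.Adj x y ∧ ¬ Br G x y) : Q = ∅ := by
  classical
  by_contra hne
  obtain ⟨x₀, hx₀⟩ := Set.nonempty_iff_ne_empty.2 hne
  obtain ⟨y₀, hy₀, hxy₀⟩ := hB x₀ hx₀
  set side : V × V → Finset V := fun e => Finset.univ.filter fun x =>
    G.Reachable e.1 x ∧ res G e.1 x = 1 + res G e.2 x with hside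
  obtain ⟨⟨p, q⟩, he, hmin⟩ := Finset.exists_min_image
    (Finset.univ.filter fun e : V × V => e.1 ∈ Q ∧ e.2 ∈ Q ∧ Br G e.1 e.2)
    (fun e => (side e).card) ⟨(x₀, y₀), by simp [hx₀, hy₀, hxy₀]⟩
  simp only [Finset.mem_filter, Finset.mem_univ, true_and] at he hmin
  obtain ⟨hp, hq, hpq⟩ := he
  obtain ⟨y, hy, hqy, hnb⟩ := hN q hq
  obtain ⟨z, hz, hyz⟩ := hB y hy
  refine (hmin (y, z) ⟨hy, hz, hyz⟩).not_gt (Finset.card_lt_card ?_)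
  rw [br_iff_not_isEdgeReachable_two hqy, not_not] at hnb
  have hpq' := hpq.1.reachable
  have hpy := hpq'.trans hqy.reachable
  have hpz := hpy.trans hyz.1.reachable
  have hys : res G p y = 1 + res G q y :=
    (isEdgeReachable_two_iff.1 hnb).2 p q hpq hpq' (by rw [hpq.2, res_self, add_zero])
  have hqs : res G z q = 1 + res G y q :=
    (isEdgeReachable_two_iff.1 hnb.symm).2 z y hyz.symm hyz.symm.1.reachable
      (by rw [hyz.symm.2, res_self, add_zero])
  have hzs : res G p z = 1 + res G q z := by
    refine (hpq.cases hpz).resolve_right fun h => ?_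
    have h1 := hpq.res_eq_add hpy hpz hys h
    rw [hyz.2] at h1
    linarith [res_pos hqy.reachable hqy.ne, res_nonneg (G := G) p z]
  refine Finset.ssubset_iff_subset_ne.2 ⟨fun x hx => ?_, fun heq => ?_⟩
  · simp only [hside, Finset.mem_filter, Finset.mem_univ, true_and] at hx ⊢
    have hpx := hpy.trans hx.1
    refine ⟨hpx, (hpq.cases hpx).resolve_right fun h => ?_⟩
    have h1 := hpq.res_eq_add hpy hpx hys h
    have h2 := hpq.res_eq_add hpz hpx hzs h
    have h3 := res_comm (G := G) z q
    have h4 := res_comm (G := G) y q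
    linarith [hx.2]
  · have hmem : q ∈ side (p, q) := by simp [hside, hpq.2, hpq']
    rw [← heq] at hmem
    simp only [hside, Finset.mem_filter, Finset.mem_univ, true_and] at hmem
    linarith [hmem.2]

end Bridges

/-! ### Isomorphism of ranked forests -/

section Forest

open Classical in
lemma exists_notMem_image_of_card_eq {α β : Type*} {A : Finset α} {φ : α → β}
    (hφ : Set.InjOn φ A) {P : Finset α} {Q : Finset β} (hcard : P.card = Q.card)
    (h : ∀ a ∈ A, a ∈ P ↔ φ a ∈ Q) : (∃ x ∈ P, x ∉ A) ↔ ∃ y ∈ Q, y ∉ A.image φ := by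
  have h1 : (Q ∩ A.image φ) = (P ∩ A).image φ := by
    ext y
    simp only [Finset.mem_inter, Finset.mem_image]
    constructor
    · rintro ⟨hy, a, ha, rfl⟩
      exact ⟨a, ⟨(h a ha).2 hy, ha⟩, rfl⟩
    · rintro ⟨a, ⟨haP, ha⟩, rfl⟩
      exact ⟨(h a ha).1 haP, a, ha, rfl⟩
  have h2 : (Q ∩ A.image φ).card = (P ∩ A).card := by
    rw [h1, Finset.card_image_of_injOn (hφ.mono (by simp))]
  have h3 : (P \ A).card = (Q \ A.image φ).card := by
    have := Finset.card_sdiff_add_card_inter P A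
    have := Finset.card_sdiff_add_card_inter Q (A.image φ)
    omega
  have h4 : (P \ A).Nonempty ↔ (Q \ A.image φ).Nonempty := by
    rw [← Finset.card_pos, h3, Finset.card_pos]
  simpa [Finset.Nonempty, Finset.mem_sdiff] using h4

variable {N₁ N₂ K L : Type*} [Fintype N₁] [Fintype N₂] [LinearOrder L]

lemma natCard_subtype {α : Type*} [Fintype α] (P : α → Prop) [DecidablePred P] :
    Nat.card {x // P x} = (Finset.univ.filter P).card := by
  rw [Nat.card_eq_fintype_card, Fintype.card_subtype]

/-- Two coloured graphs with an equitable colouring are isomorphic if every vertex has at most one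
neighbour of the same or lower rank. -/
theorem nonempty_iso_of_rank (F₁ : SimpleGraph N₁) (F₂ : SimpleGraph N₂) (f₁ : N₁ → K)
    (f₂ : N₂ → K) (rank : K → L)
    (hcard : ∀ c, Nat.card {x // f₁ x = c} = Nat.card {y // f₂ y = c})
    (hnbr : ∀ x y, f₁ x = f₂ y → ∀ c,
      Nat.card {z // F₁.Adj x z ∧ f₁ z = c} = Nat.card {z // F₂.Adj y z ∧ f₂ z = c})
    (h₁ : ∀ x z z', F₁.Adj x z → F₁.Adj x z' → rank (f₁ z) ≤ rank (f₁ x) →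
      rank (f₁ z') ≤ rank (f₁ x) → z = z')
    (h₂ : ∀ x z z', F₂.Adj x z → F₂.Adj x z' → rank (f₂ z) ≤ rank (f₂ x) →
      rank (f₂ z') ≤ rank (f₂ x) → z = z') : Nonempty (F₁ ≃g F₂) := by
  classical
  simp only [natCard_subtype] at hcard hnbr
  have hsame : ∀ x : N₁, ∃ y : N₂, f₂ y = f₁ x := by
    intro x
    have h0 : 0 < (Finset.univ.filter fun z => f₁ z = f₁ x).card :=
      Finset.card_pos.2 ⟨x, by simp⟩
    rw [hcard] at h0
    obtain ⟨y, hy⟩ := Finset.card_pos.1 h0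
    exact ⟨y, by simpa using hy⟩
  have key : ∀ n ≤ Fintype.card N₁, ∃ (A : Finset N₁) (φ : N₁ → N₂), A.card = n ∧
      Set.InjOn φ A ∧ (∀ a ∈ A, f₂ (φ a) = f₁ a) ∧
      (∀ a ∈ A, ∀ b ∈ A, F₁.Adj a b ↔ F₂.Adj (φ a) (φ b)) ∧
      ∀ a ∈ A, ∀ z ∉ A, rank (f₁ a) ≤ rank (f₁ z) := by
    intro n
    induction n with
    | zero =>
      intro _
      choose φ hφ using hsame
      exact ⟨∅, φ, by simp⟩
    | succ n ih =>
      intro hn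
      obtain ⟨A, φ, hA, hinj, hcol, hadj, hrank⟩ := ih (by omega)
      obtain ⟨v₀, hv₀, hmin₀⟩ : ∃ v ∉ A, ∀ z ∉ A, rank (f₁ v) ≤ rank (f₁ z) := by
        have hne : Aᶜ.Nonempty := by
          rw [← Finset.card_pos, Finset.card_compl]
          omega
        obtain ⟨v, hv, hmin⟩ := Finset.exists_min_image Aᶜ (fun z => rank (f₁ z)) hne
        exact ⟨v, by simpa using hv, fun z hz => hmin z (by simpa using hz)⟩
      have hout : ∀ a ∈ A, ∀ c, (∃ z, F₁.Adj a z ∧ f₁ z = c ∧ z ∉ A) ↔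
          ∃ z, F₂.Adj (φ a) z ∧ f₂ z = c ∧ z ∉ A.image φ := by
        intro a ha c
        have := exists_notMem_image_of_card_eq hinj (hnbr a (φ a) (hcol a ha).symm c) (by
          intro b hb
          simp [hadj a ha b hb, hcol b hb])
        simpa only [Finset.mem_filter, Finset.mem_univ, true_and, and_assoc] using this
      have hrank₂ : ∀ a ∈ A, ∀ z ∉ A.image φ, rank (f₁ a) ≤ rank (f₂ z) := by
        intro a ha z hz
        obtain ⟨w, hw, hwA⟩ := (exists_notMem_image_of_card_eq hinj (hcard (f₂ z)) (by
          intro b hb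
          simp [hcol b hb])).2 ⟨z, by simp, hz⟩
        rw [← (by simpa using hw : f₁ w = f₂ z)]
        exact hrank a ha w hwA
      obtain ⟨v, v', hv, hv', hvcol, hmin, hvadj⟩ : ∃ v v', v ∉ A ∧ v' ∉ A.image φ ∧
          f₂ v' = f₁ v ∧ (∀ z ∉ A, rank (f₁ v) ≤ rank (f₁ z)) ∧
          ∀ a ∈ A, F₁.Adj v a ↔ F₂.Adj v' (φ a) := by
        by_cases hex : ∃ v ∉ A, (∀ z ∉ A, rank (f₁ v) ≤ rank (f₁ z)) ∧ ∃ a ∈ A, F₁.Adj v a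
        · obtain ⟨v, hv, hmin, a, ha, hva⟩ := hex
          obtain ⟨v', hav', hv'col, hv'⟩ := (hout a ha (f₁ v)).1 ⟨v, hva.symm, rfl, hv⟩
          refine ⟨v, v', hv, hv', hv'col, hmin, fun b hb => ⟨fun h => ?_, fun h => ?_⟩⟩
          · rw [h₁ v b a h hva (hrank b hb v hv) (hrank a ha v hv)]
            exact hav'.symm
          · have := h₂ v' (φ b) (φ a) h hav'.symm
              (by rw [hcol b hb]; exact hrank₂ b hb v' hv')
              (by rw [hcol a ha]; exact hrank₂ a ha v' hv')
            rwa [hinj hb ha this]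
        · obtain ⟨v', hv'c, hv'⟩ := (exists_notMem_image_of_card_eq hinj (hcard (f₁ v₀)) (by
            intro b hb
            simp [hcol b hb])).1 ⟨v₀, by simp, hv₀⟩
          have hv'c : f₂ v' = f₁ v₀ := by simpa using hv'c
          refine ⟨v₀, v', hv₀, hv', hv'c, hmin₀, fun b hb => iff_of_false (fun h => ?_)
            fun h => ?_⟩
          · exact hex ⟨v₀, hv₀, hmin₀, b, hb, h⟩
          · obtain ⟨z, hbz, hz, hzA⟩ := (hout b hb (f₁ v₀)).2 ⟨v', h.symm, hv'c, hv'⟩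
            exact hex ⟨z, hzA, by rwa [hz], b, hb, hbz.symm⟩
      have hne : ∀ a ∈ A, a ≠ v := fun a ha => by rintro rfl; exact hv ha
      have hupd : ∀ a ∈ A, Function.update φ v v' a = φ a := fun a ha =>
        Function.update_of_ne (hne a ha) _ _
      refine ⟨insert v A, Function.update φ v v', by rw [Finset.card_insert_of_notMem hv, hA],
        ?_, ?_, ?_, ?_⟩
      · rw [Finset.coe_insert, Set.injOn_insert (by simpa using hv)]
        refine ⟨fun a ha b hb hab => hinj ha hb ?_, ?_⟩
        · rwa [hupd a ha, hupd b hb] at hab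
        · rintro ⟨a, ha, hav⟩
          rw [hupd a ha, Function.update_self] at hav
          exact hv' (Finset.mem_image.2 ⟨a, ha, hav⟩)
      · intro a ha
        rcases Finset.mem_insert.1 ha with rfl | ha
        · rw [Function.update_self, hvcol]
        · rw [hupd a ha, hcol a ha]
      · intro a ha b hb
        rcases Finset.mem_insert.1 ha with ha' | ha' <;>
          rcases Finset.mem_insert.1 hb with hb' | hb'
        · simp [ha', hb']
        · rw [ha', Function.update_self, hupd b hb', hvadj b hb']
        · rw [hb', Function.update_self, hupd a ha', F₁.adj_comm, hvadj a ha', F₂.adj_comm]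
        · rw [hupd a ha', hupd b hb', hadj a ha' b hb']
      · intro a ha z hz
        rw [Finset.mem_insert, not_or] at hz
        rcases Finset.mem_insert.1 ha with rfl | ha
        · exact hmin z hz.2
        · exact hrank a ha z hz.2
  obtain ⟨A, φ, hA, hinj, hcol, hadj, -⟩ := key _ le_rfl
  obtain rfl := (Finset.card_eq_iff_eq_univ A).1 hA
  have hsurj : Function.Surjective φ := by
    intro y
    by_contra hy
    obtain ⟨w, -, hw⟩ := (exists_notMem_image_of_card_eq hinj (hcard (f₂ y)) (by
      intro b hb
      simp [hcol b hb])).2 ⟨y, by simp, by simpa using hy⟩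
    exact hw (Finset.mem_univ w)
  refine ⟨⟨Equiv.ofBijective φ ⟨fun a b => hinj (by simp) (by simp), hsurj⟩, ?_⟩⟩
  intro a b
  exact (hadj a (Finset.mem_univ a) b (Finset.mem_univ b)).symm

end Forest

/-! ### Quantities determined by the colours -/

section Definability

open scoped Classical NNReal

variable {C : Type v} (prof : C → Multiset ((ℕ∞ × ℝ≥0∞) × C))

/-- The eccentricity of the vertices of colour `c`. -/
noncomputable def eccC (c : C) : ℝ := (((prof c).map fun e => resValue e.1).sup : ℝ≥0)

/-- For a relation `A` (between a colour and a distance-colour pair seen from there) that expresses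
ancestry: the colour of the ancestor of maximal eccentricity. -/
noncomputable def maxC (A : C → (ℕ∞ × ℝ≥0∞) × C → Prop) (c : C) : Option C :=
  if h : ∃ e ∈ prof c, A c e ∧ ∀ e' ∈ prof c, A c e' → eccC prof e'.2 ≤ eccC prof e.2 then
    some h.choose.2 else none

/-- The relation of having the same closest ancestor and satisfying a distance bound. -/
def SameE (mx : C → Option C) (cmp : ℝ → ℝ → Prop) (c : C) (e : (ℕ∞ × ℝ≥0∞) × C) : Prop :=
  e.1.1 ≠ ⊤ ∧ (mx c = none ∧ mx e.2 = none ∨ ∃ a b, mx c = some a ∧ mx e.2 = some b ∧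
    eccC prof a = eccC prof b ∧
      cmp (resValue e.1) ((eccC prof c - eccC prof a) + (eccC prof e.2 - eccC prof b)))

/-- The multiset of the colours of the class of a vertex of colour `c`. -/
noncomputable def classC (R : C → (ℕ∞ × ℝ≥0∞) × C → Prop) (c : C) : Multiset C :=
  ((prof c).filter (R c)).map Prod.snd

variable {prof} {V : Type u} [Fintype V] {G : SimpleGraph V} {f : V → C}
  (hs : IsStable (spdRd G) f prof)

lemma spdRd_fst_eq_zero_iff {x y : V} : (spdRd G x y).1 = 0 ↔ x = y :=
  SimpleGraph.edist_eq_zero_iff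

lemma spdRd_fst_eq_one_iff {x y : V} : (spdRd G x y).1 = 1 ↔ G.Adj x y :=
  SimpleGraph.edist_eq_one_iff_adj

lemma spdRd_fst_ne_top_iff {x y : V} : (spdRd G x y).1 ≠ ⊤ ↔ G.Reachable x y := by
  rw [Ne, spdRd, edist_eq_top_iff, not_not]

include hs

namespace IsStable

lemma mem_iff {x : V} {e : (ℕ∞ × ℝ≥0∞) × C} :
    e ∈ prof (f x) ↔ ∃ y, (spdRd G x y, f y) = e := by
  rw [← hs x]
  simp

lemma exists_mem_iff {x : V} {P : (ℕ∞ × ℝ≥0∞) × C → Prop} :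
    (∃ e ∈ prof (f x), P e) ↔ ∃ y, P (spdRd G x y, f y) := by
  simp [hs.mem_iff]

lemma forall_mem_iff {x : V} {P : (ℕ∞ × ℝ≥0∞) × C → Prop} :
    (∀ e ∈ prof (f x), P e) ↔ ∀ y, P (spdRd G x y, f y) := by
  simp only [hs.mem_iff]
  exact ⟨fun h y => h _ ⟨y, rfl⟩, by rintro h _ ⟨y, rfl⟩; exact h y⟩

lemma natCard_eq_countP (x : V) (P : (ℕ∞ × ℝ≥0∞) × C → Prop) [DecidablePred P] :
    Nat.card {y // P (spdRd G x y, f y)} = (prof (f x)).countP P := by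
  rw [← hs x, Multiset.countP_map, natCard_subtype]
  rfl

lemma ecc_eq (x : V) : ecc G x = eccC prof (f x) := by
  rw [eccC, ← hs x, Multiset.map_map]
  rfl

variable {A : C → (ℕ∞ × ℝ≥0∞) × C → Prop} {anc : V → V → Prop}

lemma maxC_spec (hA : ∀ u x, anc u x ↔ A (f x) (spdRd G x u, f u)) {x : V} :
    (∃ e ∈ prof (f x), A (f x) e ∧ ∀ e' ∈ prof (f x), A (f x) e' →
      eccC prof e'.2 ≤ eccC prof e.2) ↔ ∃ p, anc p x ∧ ∀ u, anc u x → ecc G u ≤ ecc G p := by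
  simp only [hs.exists_mem_iff, hs.forall_mem_iff, hA, hs.ecc_eq]

lemma exists_of_maxC_eq_some (hA : ∀ u x, anc u x ↔ A (f x) (spdRd G x u, f u)) {x : V} {c : C}
    (h : maxC prof A (f x) = some c) :
    ∃ p, f p = c ∧ anc p x ∧ ∀ u, anc u x → ecc G u ≤ ecc G p := by
  rw [maxC] at h
  split_ifs at h with hex
  obtain ⟨h1, h2, h3⟩ := hex.choose_spec
  obtain ⟨p, hp⟩ := hs.mem_iff.1 h1
  rw [← hp] at h2 h3
  refine ⟨p, ?_, (hA p x).2 h2, fun u hu => ?_⟩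
  · rw [← Option.some.inj h, ← hp]
  · rw [hs.ecc_eq, hs.ecc_eq]
    exact h3 (spdRd G x u, f u) (hs.mem_iff.2 ⟨u, rfl⟩) ((hA u x).1 hu)

lemma maxC_eq_some (hA : ∀ u x, anc u x ↔ A (f x) (spdRd G x u, f u))
    (hu : ∀ u v x, anc u x → anc v x → ecc G u = ecc G v → u = v) {p x : V}
    (hp : anc p x ∧ ∀ u, anc u x → ecc G u ≤ ecc G p) : maxC prof A (f x) = some (f p) := by
  have hex := (hs.maxC_spec hA).2 ⟨p, hp⟩
  have h : maxC prof A (f x) = some hex.choose.2 := dif_pos hex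
  obtain ⟨q, hq, hq'⟩ := hs.exists_of_maxC_eq_some hA h
  rw [h, ← hq, hu q p x hq'.1 hp.1 (le_antisymm (hp.2 q hq'.1) (hq'.2 p hp.1))]

lemma maxC_eq_none_iff (hA : ∀ u x, anc u x ↔ A (f x) (spdRd G x u, f u)) {x : V} :
    maxC prof A (f x) = none ↔ ∀ u, ¬ anc u x := by
  rw [maxC, dite_eq_right_iff]
  constructor
  · intro h u hu
    obtain ⟨p, hp, hmax⟩ := Finset.exists_max_image (Finset.univ.filter (anc · x)) (ecc G)
      ⟨u, by simpa using hu⟩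
    simp only [Finset.mem_filter, Finset.mem_univ, true_and] at hp hmax
    exact absurd (h ((hs.maxC_spec hA).2 ⟨p, hp, hmax⟩)) (by simp)
  · intro h hex
    obtain ⟨p, hp, -⟩ := (hs.maxC_spec hA).1 hex
    exact absurd hp (h p)

lemma sameE_iff (hA : ∀ u x, anc u x ↔ A (f x) (spdRd G x u, f u))
    (hu : ∀ u v x, anc u x → anc v x → ecc G u = ecc G v → u = v) {cmp : ℝ → ℝ → Prop}
    {x y : V} : SameE prof (maxC prof A) cmp (f x) (spdRd G x y, f y) ↔
      G.Reachable x y ∧ ((∀ u, ¬ anc u x) ∧ (∀ u, ¬ anc u y) ∨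
        ∃ p q, (anc p x ∧ ∀ u, anc u x → ecc G u ≤ ecc G p) ∧
          (anc q y ∧ ∀ u, anc u y → ecc G u ≤ ecc G q) ∧ ecc G p = ecc G q ∧
          cmp (res G x y) ((ecc G x - ecc G p) + (ecc G y - ecc G q))) := by
  rw [SameE, spdRd_fst_ne_top_iff, hs.maxC_eq_none_iff hA, hs.maxC_eq_none_iff hA]
  refine and_congr_right fun _ => or_congr_right ?_
  constructor
  · rintro ⟨a, b, ha, hb, h⟩
    obtain ⟨p, rfl, hp⟩ := hs.exists_of_maxC_eq_some hA ha
    obtain ⟨q, rfl, hq⟩ := hs.exists_of_maxC_eq_some hA hb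
    simp only [← hs.ecc_eq] at h
    exact ⟨p, q, hp, hq, h⟩
  · rintro ⟨p, q, hp, hq, h⟩
    refine ⟨f p, f q, hs.maxC_eq_some hA hu hp, hs.maxC_eq_some hA hu hq, ?_⟩
    simp only [← hs.ecc_eq]
    exact h

lemma classC_eq {R : C → (ℕ∞ × ℝ≥0∞) × C → Prop} {r : V → V → Prop}
    (hR : ∀ x y, r x y ↔ R (f x) (spdRd G x y, f y)) (x : V) :
    classC prof R (f x) = (Finset.univ.filter (r x)).val.map f := by
  rw [classC, ← hs x, Multiset.filter_map, Multiset.map_map, Finset.filter_val]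
  simp only [hR]
  rfl

end IsStable

omit hs

/-! #### Cut vertices and blocks -/

/-- `c` sees an ancestor at `e`. -/
def AncE (prof : C → Multiset ((ℕ∞ × ℝ≥0∞) × C)) (c : C) (e : (ℕ∞ × ℝ≥0∞) × C) : Prop :=
  e.1.1 ≠ 0 ∧ e.1.1 ≠ ⊤ ∧ eccC prof c = eccC prof e.2 + resValue e.1

/-- `c` sees a descendant at `e`. -/
def DescE (prof : C → Multiset ((ℕ∞ × ℝ≥0∞) × C)) (c : C) (e : (ℕ∞ × ℝ≥0∞) × C) : Prop :=
  e.1.1 ≠ 0 ∧ e.1.1 ≠ ⊤ ∧ eccC prof e.2 = eccC prof c + resValue e.1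

/-- `c` is the colour of cut vertices. -/
def CutC (prof : C → Multiset ((ℕ∞ × ℝ≥0∞) × C)) (c : C) : Prop :=
  ∃ e ∈ prof c, DescE prof c e

/-- The colour of the closest ancestor. -/
noncomputable def parC (prof : C → Multiset ((ℕ∞ × ℝ≥0∞) × C)) : C → Option C :=
  maxC prof (AncE prof)

/-- `c` sees a vertex of the same upper block at `e`. -/
def MateE (prof : C → Multiset ((ℕ∞ × ℝ≥0∞) × C)) : C → (ℕ∞ × ℝ≥0∞) × C → Prop :=
  SameE prof (parC prof) (· < ·)

/-- The colours in the upper block of a vertex of colour `c`. -/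
noncomputable def blockC (prof : C → Multiset ((ℕ∞ × ℝ≥0∞) × C)) (c : C) :
    Option C × Multiset C :=
  (parC prof c, classC prof (MateE prof) c)

/-- `c` is the colour of vertices that have an upper block. -/
def HasUpperC (prof : C → Multiset ((ℕ∞ × ℝ≥0∞) × C)) (c : C) : Prop :=
  parC prof c ≠ none ∨ 1 < (classC prof (MateE prof) c).card ∨ eccC prof c = 0

namespace IsStable

include hs

lemma anc_iff (u x : V) : Anc G u x ↔ AncE prof (f x) (spdRd G x u, f u) := by
  rw [Anc, AncE, ← hs.ecc_eq, ← hs.ecc_eq, spdRd_fst_ne_top_iff, res_comm u x,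
    SimpleGraph.reachable_comm]
  exact and_congr_left fun _ => not_congr spdRd_fst_eq_zero_iff.symm

lemma desc_iff (u x : V) : Anc G u x ↔ DescE prof (f u) (spdRd G u x, f x) := by
  rw [Anc, DescE, ← hs.ecc_eq, ← hs.ecc_eq, spdRd_fst_ne_top_iff, ne_comm]
  exact and_congr_left fun _ => not_congr spdRd_fst_eq_zero_iff.symm

lemma isCutVertex_iff (x : V) : IsCutVertex G x ↔ CutC prof (f x) := by
  rw [isCutVertex_iff_anc, CutC, hs.exists_mem_iff]
  exact exists_congr fun y => hs.desc_iff x y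

lemma parC_eq_some {p x : V} (h : Par G p x) : parC prof (f x) = some (f p) :=
  hs.maxC_eq_some hs.anc_iff (fun _ _ _ hu hv he => hv.eq_of_ecc_eq hu he) h

lemma exists_par_of_parC {x : V} {c : C} (h : parC prof (f x) = some c) :
    ∃ p, f p = c ∧ Par G p x :=
  hs.exists_of_maxC_eq_some hs.anc_iff h

lemma parC_eq_none_iff {x : V} : parC prof (f x) = none ↔ ∀ u, ¬ Anc G u x :=
  hs.maxC_eq_none_iff hs.anc_iff

lemma par_iff (p x : V) :
    Par G p x ↔ DescE prof (f p) (spdRd G p x, f x) ∧ parC prof (f x) = some (f p) := by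
  constructor
  · exact fun h => ⟨(hs.desc_iff p x).1 h.1, hs.parC_eq_some h⟩
  · rintro ⟨h1, h2⟩
    obtain ⟨q, hq, hqx⟩ := hs.exists_par_of_parC h2
    rwa [hqx.1.eq_of_ecc_eq ((hs.desc_iff p x).2 h1) (by rw [hs.ecc_eq, hs.ecc_eq, hq])]

lemma mate_iff (x y : V) : Mate G x y ↔ MateE prof (f x) (spdRd G x y, f y) :=
  GDWL.mate_iff.trans
    (hs.sameE_iff hs.anc_iff (fun _ _ _ hu hv he => hv.eq_of_ecc_eq hu he)).symm

lemma blockC_eq {x y : V} (h : Mate G x y) : blockC prof (f x) = blockC prof (f y) := by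
  have h1 : parC prof (f x) = parC prof (f y) := by
    by_cases hp : ∃ p, Par G p x
    · obtain ⟨p, hp⟩ := hp
      rw [hs.parC_eq_some hp, hs.parC_eq_some (h.par hp)]
    · have hx : ∀ u, ¬ Anc G u x := fun u hu => hp hu.exists_par
      have hy : ∀ u, ¬ Anc G u y := fun u hu => by
        obtain ⟨p, hp'⟩ := hu.exists_par
        exact hp ⟨p, h.symm.par hp'⟩
      rw [hs.parC_eq_none_iff.2 hx, hs.parC_eq_none_iff.2 hy]
  have h2 : Mate G x = Mate G y := by
    ext z
    exact ⟨h.symm.trans, h.trans⟩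
  rw [blockC, blockC, h1, hs.classC_eq hs.mate_iff, hs.classC_eq hs.mate_iff, h2]

lemma hasUpperBlock_iff (x : V) : HasUpperBlock G x ↔ HasUpperC prof (f x) := by
  rw [HasUpperBlock, HasUpperC, ← hs.ecc_eq, hs.classC_eq hs.mate_iff]
  refine or_congr ?_ (or_congr ?_ Iff.rfl)
  · rw [Ne, hs.parC_eq_none_iff]
    push Not
    exact ⟨fun ⟨p, hp⟩ => ⟨p, hp.1⟩, fun ⟨u, hu⟩ => hu.exists_par⟩
  · rw [Multiset.card_map, ← Finset.card_def, Finset.one_lt_card_iff_nontrivial,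
      Finset.Nontrivial, Set.nontrivial_iff_exists_ne (x := x) (by simp [Mate.refl])]
    simp only [Finset.coe_filter, Finset.mem_univ, true_and, Set.mem_ofPred_eq]
    exact exists_congr fun y => and_comm

lemma map_upperBlock (x : V) :
    ((Finset.univ.filter (· ∈ upperBlock G x)).val.map f) =
      (blockC prof (f x)).2 + ((blockC prof (f x)).1.elim 0 fun c => {c}) := by
  have hsub : Finset.univ.filter (· ∈ upperBlock G x) =
      (Finset.univ.filter (Mate G x)).disjUnion (Finset.univ.filter (Par G · x)) (by
        rw [Finset.disjoint_filter]
        intro y _ h1 h2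
        linarith [(h1.par h2).1.ecc_lt]) := by
    ext y
    simp only [Finset.mem_filter, Finset.mem_univ, true_and, Finset.mem_disjUnion]
    rfl
  rw [hsub, Finset.disjUnion_val, Multiset.map_add, blockC, hs.classC_eq hs.mate_iff]
  congr 1
  by_cases hp : ∃ p, Par G p x
  · obtain ⟨p, hp⟩ := hp
    have : Finset.univ.filter (Par G · x) = {p} := by
      ext y
      simp only [Finset.mem_filter, Finset.mem_univ, true_and, Finset.mem_singleton]
      exact ⟨fun h => h.unique hp, by rintro rfl; exact hp⟩
    rw [this, hs.parC_eq_some hp]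
    rfl
  · have hx : ∀ u, ¬ Anc G u x := fun u hu => hp hu.exists_par
    have : Finset.univ.filter (Par G · x) = ∅ := by
      ext y
      simpa using fun h : Par G y x => hx y h.1
    rw [this, hs.parC_eq_none_iff.2 hx]
    rfl

end IsStable

/-! #### Bridges and edge-biconnected components -/

/-- `c` sees a neighbour along a bridge at `e`. -/
def BrE (e : (ℕ∞ × ℝ≥0∞) × C) : Prop := e.1.1 = 1 ∧ (resValue e.1 : ℝ) = 1

/-- `c` is the colour of local roots. -/
def LocalRootC (prof : C → Multiset ((ℕ∞ × ℝ≥0∞) × C)) (c : C) : Prop :=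
  ∃ e ∈ prof c, BrE e ∧ eccC prof e.2 < eccC prof c + 1

/-- `c` sees a local root above it at `e`. -/
def EdgeAncE (prof : C → Multiset ((ℕ∞ × ℝ≥0∞) × C)) (c : C) (e : (ℕ∞ × ℝ≥0∞) × C) : Prop :=
  LocalRootC prof e.2 ∧ e.1.1 ≠ ⊤ ∧ eccC prof c = eccC prof e.2 + resValue e.1

/-- The colour of the closest local root. -/
noncomputable def topC (prof : C → Multiset ((ℕ∞ × ℝ≥0∞) × C)) : C → Option C :=
  maxC prof (EdgeAncE prof)

/-- `c` sees a vertex of the same edge-biconnected component at `e`. -/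
def EdgeMateE (prof : C → Multiset ((ℕ∞ × ℝ≥0∞) × C)) : C → (ℕ∞ × ℝ≥0∞) × C → Prop :=
  SameE prof (topC prof) (· ≤ ·)

/-- The colours in the edge-biconnected component of a vertex of colour `c`. -/
noncomputable def compC (prof : C → Multiset ((ℕ∞ × ℝ≥0∞) × C)) (c : C) : Multiset C :=
  classC prof (EdgeMateE prof) c

/-- The rank of the edge-biconnected component of a vertex of colour `c`. -/
noncomputable def topRankC (prof : C → Multiset ((ℕ∞ × ℝ≥0∞) × C)) (c : C) : ℝ :=
  (topC prof c).elim (-1) (eccC prof)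

lemma br_iff (x y : V) : Br G x y ↔ BrE (spdRd G x y, f y) := by
  rw [Br, BrE, spdRd_fst_eq_one_iff]
  rfl

namespace IsStable

include hs

lemma localRoot_iff (x : V) : LocalRoot G x ↔ LocalRootC prof (f x) := by
  rw [LocalRoot, LocalRootC, hs.exists_mem_iff]
  refine exists_congr fun p => ?_
  rw [hs.ecc_eq, hs.ecc_eq, ← br_iff]
  exact and_congr_left fun _ => ⟨Br.symm, Br.symm⟩

lemma edgeAnc_iff (u x : V) : EdgeAnc G u x ↔ EdgeAncE prof (f x) (spdRd G x u, f u) := by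
  rw [EdgeAnc, EdgeAncE, hs.localRoot_iff, ← hs.ecc_eq, ← hs.ecc_eq, spdRd_fst_ne_top_iff,
    res_comm u x, SimpleGraph.reachable_comm]
  rfl

lemma topRank_eq (x : V) : topRank G x = topRankC prof (f x) := by
  by_cases hx : ∃ t, Top G t x
  · obtain ⟨t, ht⟩ := hx
    have h : topC prof (f x) = some (f t) :=
      hs.maxC_eq_some hs.edgeAnc_iff (fun _ _ _ hu hv he => hu.eq_of_ecc_eq hv he) ht
    rw [ht.topRank_eq, topRankC, h, hs.ecc_eq]
    rfl
  · have h : topC prof (f x) = none :=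
      (hs.maxC_eq_none_iff hs.edgeAnc_iff).2 fun u hu => hx hu.exists_top
    rw [topRank, dif_neg hx, topRankC, h]
    rfl

lemma isEdgeReachable_two_iff (x y : V) :
    G.IsEdgeReachable 2 x y ↔ EdgeMateE prof (f x) (spdRd G x y, f y) :=
  isEdgeReachable_two_iff_top.trans
    (hs.sameE_iff hs.edgeAnc_iff (fun _ _ _ hu hv he => hu.eq_of_ecc_eq hv he)).symm

lemma compC_eq (x : V) :
    compC prof (f x) = (Finset.univ.filter (G.IsEdgeReachable 2 x)).val.map f :=
  hs.classC_eq hs.isEdgeReachable_two_iff x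

lemma compC_eq_of_isEdgeReachable_two {x y : V} (h : G.IsEdgeReachable 2 x y) :
    compC prof (f x) = compC prof (f y) := by
  have h2 : G.IsEdgeReachable 2 x = G.IsEdgeReachable 2 y := by
    ext z
    exact ⟨h.symm.trans, h.trans⟩
  rw [hs.compC_eq, hs.compC_eq, h2]

end IsStable

end Definability

/-! ### Reconstruction of the block trees -/

section Trees

open scoped Classical

lemma card_mul_eq_of_fibers {α β : Type*} {s : Finset α} {t : Finset β} (r : α → β → Prop)
    [∀ a b, Decidable (r a b)] {k : ℕ}
    (h₁ : ∀ a ∈ s, (t.filter (r a)).card = 1) (h₂ : ∀ b ∈ t, (s.filter fun a => r a b).card = k) :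
    t.card * k = s.card := by
  rw [← mul_one s.card]
  exact (Finset.card_mul_eq_card_mul r h₁ h₂).symm

lemma natCard_eq_of_mul_eq {α β : Type*} [Finite α] [Finite β] {P : α → Prop} {Q : β → Prop} {k : ℕ}
    (h : Nat.card {a // P a} * k = Nat.card {b // Q b} * k) (hP : ∀ a, P a → k ≠ 0)
    (hQ : ∀ b, Q b → k ≠ 0) : Nat.card {a // P a} = Nat.card {b // Q b} := by
  by_cases hk : k = 0
  · have h1 : IsEmpty {a // P a} := ⟨fun a => hP a a.2 hk⟩
    have h2 : IsEmpty {b // Q b} := ⟨fun b => hQ b b.2 hk⟩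
    rw [Nat.card_of_isEmpty, Nat.card_of_isEmpty]
  · exact Nat.eq_of_mul_eq_mul_right (Nat.pos_of_ne_zero hk) h

lemma natCard_subtype_sum {α β : Type*} [Finite α] [Finite β] (P : α ⊕ β → Prop) :
    Nat.card {x // P x} = Nat.card {a // P (.inl a)} + Nat.card {b // P (.inr b)} := by
  rw [← Nat.card_sum]
  exact Nat.card_congr Equiv.subtypeSum

variable {C : Type v} {prof : C → Multiset ((ℕ∞ × ℝ≥0∞) × C)} {V : Type u} [Fintype V]
  {G : SimpleGraph V} {f : V → C}

/-! #### The block cut-edge tree -/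

variable (G) in
/-- The edge-biconnected component of a vertex. -/
def compNode (x : V) : {S : Set V // IsEdgeBCC G S} :=
  ⟨{y | G.IsEdgeReachable 2 x y}, isEdgeBCC_iff.2 ⟨x, rfl⟩⟩

lemma exists_compNode_eq (S : {S : Set V // IsEdgeBCC G S}) : ∃ x, compNode G x = S := by
  obtain ⟨x, hx⟩ := isEdgeBCC_iff.1 S.2
  exact ⟨x, Subtype.ext hx.symm⟩

lemma mem_compNode {x y : V} : y ∈ (compNode G x).1 ↔ G.IsEdgeReachable 2 x y := Iff.rfl

lemma compNode_eq_iff {x y : V} : compNode G x = compNode G y ↔ G.IsEdgeReachable 2 x y := by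
  constructor
  · intro h
    rw [← mem_compNode, h]
    exact SimpleGraph.IsEdgeReachable.rfl
  · intro h
    refine Subtype.ext (Set.ext fun z => ?_)
    exact ⟨h.symm.trans, h.trans⟩

lemma bceTree_adj_iff {x : V} {S : {S : Set V // IsEdgeBCC G S}} :
    (BCETree G).Adj (compNode G x) S ↔
      ∃ p q, G.IsEdgeReachable 2 x p ∧ Br G p q ∧ compNode G q = S := by
  have key : ∀ {x y p q}, compNode G x ≠ compNode G y → G.IsEdgeReachable 2 x p →
      G.IsEdgeReachable 2 y q → G.Adj p q → Br G p q := by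
    intro x y p q hne hp hq hpq
    rw [br_iff_not_isEdgeReachable_two hpq]
    exact fun h => hne (compNode_eq_iff.2 ((hp.trans h).trans hq.symm))
  obtain ⟨y, rfl⟩ := exists_compNode_eq S
  rw [BCETree, SimpleGraph.fromRel_adj]
  constructor
  · rintro ⟨hne, ⟨p, hp, q, hq, hpq⟩ | ⟨q, hq, p, hp, hpq⟩⟩
    · exact ⟨p, q, hp, key hne hp hq hpq, compNode_eq_iff.2 (mem_compNode.1 hq).symm⟩
    · exact ⟨p, q, hp, key hne hp hq hpq.symm, compNode_eq_iff.2 (mem_compNode.1 hq).symm⟩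
  · rintro ⟨p, q, hp, hb, hq⟩
    rw [compNode_eq_iff] at hq
    refine ⟨fun h => ?_, .inl ⟨p, hp, q, hq.symm, hb.1⟩⟩
    rw [compNode_eq_iff] at h
    exact (br_iff_not_isEdgeReachable_two hb.1).1 hb ((hp.symm.trans h).trans hq.symm)

/-- The multiset of the colours in a set. -/
noncomputable def setColor (f : V → C) (S : Set V) : Multiset C :=
  (Finset.univ.filter (· ∈ S)).val.map f

lemma card_setColor (S : Set V) :
    (setColor f S).card = (Finset.univ.filter (· ∈ S)).card := Multiset.card_map _ _

/-- The rank of an edge-biconnected component with the given multiset of colours. -/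
noncomputable def compRankC (prof : C → Multiset ((ℕ∞ × ℝ≥0∞) × C)) (m : Multiset C) : ℝ :=
  if h : ∃ c, c ∈ m then topRankC prof h.choose else 0

namespace IsStable

variable (hs : IsStable (spdRd G) f prof)

include hs

lemma setColor_compNode (x : V) : setColor f (compNode G x).1 = compC prof (f x) :=
  (hs.compC_eq x).symm

lemma compRankC_compNode (x : V) :
    compRankC prof (setColor f (compNode G x).1) = topRank G x := by
  have hmem : ∀ c, c ∈ setColor f (compNode G x).1 ↔ ∃ y, G.IsEdgeReachable 2 x y ∧ f y = c := by
    intro c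
    simp [setColor, mem_compNode]
  have hex : ∃ c, c ∈ setColor f (compNode G x).1 :=
    ⟨f x, (hmem _).2 ⟨x, SimpleGraph.IsEdgeReachable.rfl, rfl⟩⟩
  rw [compRankC, dif_pos hex]
  obtain ⟨y, hy, hy'⟩ := (hmem _).1 hex.choose_spec
  rw [← hy', ← hs.topRank_eq, topRank_eq_of_isEdgeReachable_two hy]

lemma card_compNode_mul (m : Multiset C) :
    Nat.card {S : {S : Set V // IsEdgeBCC G S} // setColor f S.1 = m} * m.card =
      (Finset.univ.val.map f).countP fun c => compC prof c = m := by
  rw [Multiset.countP_map, natCard_subtype]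
  refine card_mul_eq_of_fibers (s := Finset.univ.filter fun x => compC prof (f x) = m)
    (fun x S => x ∈ S.1) (fun x hx => ?_) fun S hS => ?_
  · rw [Finset.card_eq_one]
    refine ⟨compNode G x, ?_⟩
    ext S
    obtain ⟨y, rfl⟩ := exists_compNode_eq S
    simp only [Finset.mem_filter, Finset.mem_univ, true_and, Finset.mem_singleton, mem_compNode,
      compNode_eq_iff, hs.setColor_compNode] at hx ⊢
    exact ⟨fun h => h.2, fun h => ⟨(hs.compC_eq_of_isEdgeReachable_two h).trans hx, h⟩⟩
  · obtain ⟨y, rfl⟩ := exists_compNode_eq S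
    simp only [Finset.mem_filter, Finset.mem_univ, true_and] at hS
    rw [← hS, card_setColor]
    congr 1
    ext x
    simp only [Finset.mem_filter, Finset.mem_univ, true_and, mem_compNode]
    refine ⟨fun h => h.2, fun h => ⟨?_, h⟩⟩
    rw [← hs.compC_eq_of_isEdgeReachable_two h, ← hs.setColor_compNode]

lemma card_bceTree_neighbors (S : {S : Set V // IsEdgeBCC G S}) (m : Multiset C) :
    Nat.card {S' // (BCETree G).Adj S S' ∧ setColor f S'.1 = m} =
      ((setColor f S.1).map fun c =>
        (prof c).countP fun e => BrE e ∧ compC prof e.2 = m).sum := by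
  obtain ⟨x, rfl⟩ := exists_compNode_eq S
  have hpairs : ((setColor f (compNode G x).1).map fun c =>
      (prof c).countP fun e => BrE e ∧ compC prof e.2 = m).sum =
      ((Finset.univ.filter (· ∈ (compNode G x).1)).sigma fun p =>
        Finset.univ.filter fun q => Br G p q ∧ compC prof (f q) = m).card := by
    rw [setColor, Multiset.map_map, Finset.card_sigma]
    refine Finset.sum_congr rfl fun p _ => ?_
    rw [Function.comp_apply, ← hs.natCard_eq_countP p, ← natCard_subtype]
    simp only [← br_iff]
  rw [hpairs, natCard_subtype, ← Finset.card_image_of_injOn (f := fun e : (_ : V) × V => compNode G e.2)]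
  · congr 1
    ext S
    simp only [Finset.mem_filter, Finset.mem_univ, true_and, Finset.mem_image, Finset.mem_sigma,
      mem_compNode, bceTree_adj_iff, Sigma.exists]
    constructor
    · rintro ⟨⟨p, q, hp, hb, rfl⟩, hm⟩
      exact ⟨p, q, ⟨hp, hb, by rw [← hs.setColor_compNode, hm]⟩, rfl⟩
    · rintro ⟨p, q, ⟨hp, hb, hm⟩, rfl⟩
      exact ⟨⟨p, q, hp, hb, rfl⟩, by rw [hs.setColor_compNode, hm]⟩
  · rintro ⟨p, q⟩ hpq ⟨p', q'⟩ hpq' h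
    simp only [Finset.coe_sigma, Finset.coe_filter, Finset.mem_univ, true_and, Set.mem_sigma_iff,
      Set.mem_ofPred_eq, mem_compNode] at hpq hpq' h
    rw [compNode_eq_iff] at h
    obtain ⟨rfl, rfl⟩ := hpq.2.1.eq_of_isEdgeReachable_two hpq'.2.1 (hpq.1.symm.trans hpq'.1) h
    rfl

lemma bceTree_rank {S S₁ S₂ : {S : Set V // IsEdgeBCC G S}} (h₁ : (BCETree G).Adj S S₁)
    (h₂ : (BCETree G).Adj S S₂)
    (hr₁ : compRankC prof (setColor f S₁.1) ≤ compRankC prof (setColor f S.1))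
    (hr₂ : compRankC prof (setColor f S₂.1) ≤ compRankC prof (setColor f S.1)) : S₁ = S₂ := by
  obtain ⟨x, rfl⟩ := exists_compNode_eq S
  obtain ⟨p, q, hp, hb, rfl⟩ := bceTree_adj_iff.1 h₁
  obtain ⟨p', q', hp', hb', rfl⟩ := bceTree_adj_iff.1 h₂
  rw [hs.compRankC_compNode, hs.compRankC_compNode] at hr₁ hr₂
  rw [topRank_eq_of_isEdgeReachable_two hp] at hr₁
  rw [topRank_eq_of_isEdgeReachable_two hp'] at hr₂
  rw [hb.symm.isEdgeReachable_two_of_topRank_le hb'.symm (hp.symm.trans hp') hr₁ hr₂]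

end IsStable

lemma card_setColor_ne_zero {S : Set V} (h : IsEdgeBCC G S) : (setColor f S).card ≠ 0 := by
  obtain ⟨x, rfl⟩ := isEdgeBCC_iff.1 h
  rw [card_setColor, Finset.card_ne_zero]
  exact ⟨x, by simp [SimpleGraph.IsEdgeReachable.rfl]⟩

theorem nonempty_bceTree_iso {W : Type u} [Fintype W] {H : SimpleGraph W} {g : W → C}
    (hs : IsStable (spdRd G) f prof) (hs' : IsStable (spdRd H) g prof)
    (hmap : Finset.univ.val.map f = Finset.univ.val.map g) :
    Nonempty (BCETree G ≃g BCETree H) := by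
  refine nonempty_iso_of_rank (BCETree G) (BCETree H) (fun S => setColor f S.1)
    (fun S => setColor g S.1) (compRankC prof) (fun m => ?_) (fun S S' h m => ?_)
    (fun S S₁ S₂ => hs.bceTree_rank) (fun S S₁ S₂ => hs'.bceTree_rank)
  · refine natCard_eq_of_mul_eq (k := m.card) ?_ ?_ ?_
    · rw [hs.card_compNode_mul, hs'.card_compNode_mul, hmap]
    · rintro S rfl
      exact card_setColor_ne_zero S.2
    · rintro S rfl
      exact card_setColor_ne_zero S.2
  · have h' : setColor f S.1 = setColor g S'.1 := h
    rw [hs.card_bceTree_neighbors, hs'.card_bceTree_neighbors, h']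

/-! #### The block cut-vertex tree -/

omit [Fintype V] in
lemma bcvTree_adj_inl_inr {S : {S : Set V // IsVertexBCC G S}} {v : {v : V // IsCutVertex G v}} :
    (BCVTree G).Adj (.inl S) (.inr v) ↔ v.1 ∈ S.1 := by
  rw [BCVTree, SimpleGraph.fromRel_adj]
  constructor
  · rintro ⟨-, ⟨S', v', h, h', hm⟩ | ⟨S', v', h, h', hm⟩⟩
    · rw [Sum.inl.inj h, Sum.inr.inj h']
      exact hm
    · cases h
  · exact fun hm => ⟨Sum.inl_ne_inr, .inl ⟨S, v, rfl, rfl, hm⟩⟩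

omit [Fintype V] in
lemma bcvTree_adj_inr_inl {S : {S : Set V // IsVertexBCC G S}} {v : {v : V // IsCutVertex G v}} :
    (BCVTree G).Adj (.inr v) (.inl S) ↔ v.1 ∈ S.1 := by
  rw [SimpleGraph.adj_comm, bcvTree_adj_inl_inr]

omit [Fintype V] in
lemma not_bcvTree_adj_inl_inl {S S' : {S : Set V // IsVertexBCC G S}} :
    ¬ (BCVTree G).Adj (.inl S) (.inl S') := by
  rw [BCVTree, SimpleGraph.fromRel_adj]
  rintro ⟨-, ⟨_, _, -, h, -⟩ | ⟨_, _, -, h, -⟩⟩ <;> cases h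

omit [Fintype V] in
lemma not_bcvTree_adj_inr_inr {v v' : {v : V // IsCutVertex G v}} :
    ¬ (BCVTree G).Adj (.inr v) (.inr v') := by
  rw [BCVTree, SimpleGraph.fromRel_adj]
  rintro ⟨-, ⟨_, _, h, -⟩ | ⟨_, _, h, -⟩⟩ <;> cases h

/-- A vertex whose upper block is the given block. -/
noncomputable def blockRep (S : {S : Set V // IsVertexBCC G S}) : V :=
  (eq_upperBlock_of_isVertexBCC S.2).choose

lemma hasUpperBlock_blockRep (S : {S : Set V // IsVertexBCC G S}) :
    HasUpperBlock G (blockRep S) := (eq_upperBlock_of_isVertexBCC S.2).choose_spec.1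

lemma eq_upperBlock_blockRep (S : {S : Set V // IsVertexBCC G S}) :
    S.1 = upperBlock G (blockRep S) := (eq_upperBlock_of_isVertexBCC S.2).choose_spec.2

/-- The colour of a block. -/
noncomputable def blockColor (f : V → C) (prof : C → Multiset ((ℕ∞ × ℝ≥0∞) × C))
    (S : {S : Set V // IsVertexBCC G S}) : Option C × Multiset C :=
  blockC prof (f (blockRep S))

/-- The colour of a node of the block cut-vertex tree. -/
noncomputable def bcvColor (f : V → C) (prof : C → Multiset ((ℕ∞ × ℝ≥0∞) × C)) :
    {S : Set V // IsVertexBCC G S} ⊕ {v : V // IsCutVertex G v} → (Option C × Multiset C) ⊕ C :=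
  Sum.map (blockColor f prof) fun v => f v.1

/-- The rank of a node of the block cut-vertex tree: the eccentricity of the (topmost) cut vertex,
blocks coming after their topmost cut vertices. -/
noncomputable def bcvRankC (prof : C → Multiset ((ℕ∞ × ℝ≥0∞) × C)) :
    (Option C × Multiset C) ⊕ C → Lex (ℝ × ℕ) :=
  Sum.elim (fun b => toLex (b.1.elim (-1) (eccC prof), 1)) fun c => toLex (eccC prof c, 0)

lemma mate_blockRep {x : V} {S : {S : Set V // IsVertexBCC G S}} (h : S.1 = upperBlock G x) :
    Mate G (blockRep S) x := by
  rw [← upperBlock_eq_iff, ← h, ← eq_upperBlock_blockRep]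

namespace IsStable

variable (hs : IsStable (spdRd G) f prof)

include hs

lemma blockColor_eq {x : V} {S : {S : Set V // IsVertexBCC G S}} (h : S.1 = upperBlock G x) :
    blockColor f prof S = blockC prof (f x) := hs.blockC_eq (mate_blockRep h)

lemma card_blockColor_ne_zero (S : {S : Set V // IsVertexBCC G S}) :
    (blockColor f prof S).2.card ≠ 0 := by
  rw [blockColor, blockC, hs.classC_eq hs.mate_iff, Multiset.card_map]
  exact Finset.card_ne_zero.2 ⟨blockRep S, by simp [Mate.refl]⟩

/-- Counting the blocks satisfying `P` by counting the vertices that have such an upper block. -/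
lemma card_blocks_mul (P : Set V → Prop) (Q : V → Prop) (b : Option C × Multiset C)
    (hQ : ∀ x, Q x → HasUpperBlock G x)
    (hPQ : ∀ x, HasUpperBlock G x → (P (upperBlock G x) ↔ Q x)) :
    Nat.card {S : {S : Set V // IsVertexBCC G S} // P S.1 ∧ blockColor f prof S = b} * b.2.card =
      Nat.card {x // Q x ∧ blockC prof (f x) = b} := by
  rw [natCard_subtype, natCard_subtype]
  refine card_mul_eq_of_fibers (fun x S => S.1 = upperBlock G x) (fun x hx => ?_) fun S hS => ?_
  · simp only [Finset.mem_filter, Finset.mem_univ, true_and] at hx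
    have hup := hQ x hx.1
    rw [Finset.card_eq_one]
    refine ⟨⟨upperBlock G x, isVertexBCC_upperBlock hup⟩, ?_⟩
    ext S
    simp only [Finset.mem_filter, Finset.mem_univ, true_and, Finset.mem_singleton]
    constructor
    · exact fun h => Subtype.ext h.2
    · rintro rfl
      exact ⟨⟨(hPQ x hup).2 hx.1, by rw [hs.blockColor_eq rfl, hx.2]⟩, rfl⟩
  · simp only [Finset.mem_filter, Finset.mem_univ, true_and] at hS
    obtain ⟨hP, rfl⟩ := hS
    have hcl : (blockColor f prof S).2.card = (Finset.univ.filter (Mate G (blockRep S))).card := by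
      rw [blockColor, blockC, hs.classC_eq hs.mate_iff, Multiset.card_map]
      rfl
    rw [hcl]
    congr 1
    ext x
    simp only [Finset.mem_filter, Finset.mem_univ, true_and]
    constructor
    · exact fun h => mate_blockRep h.2
    · intro h
      have hx : S.1 = upperBlock G x := by
        rw [eq_upperBlock_blockRep S, upperBlock_eq_iff]
        exact h
      refine ⟨⟨?_, (hs.blockC_eq h).symm⟩, hx⟩
      rw [← hPQ x (h.hasUpperBlock (hasUpperBlock_blockRep S)), ← hx]
      exact hP

lemma card_blocks_mul_eq_countP (b : Option C × Multiset C) :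
    Nat.card {S : {S : Set V // IsVertexBCC G S} // blockColor f prof S = b} * b.2.card =
      (Finset.univ.val.map f).countP fun c => HasUpperC prof c ∧ blockC prof c = b := by
  have := hs.card_blocks_mul (fun _ => True) (HasUpperBlock G) b (fun _ h => h)
    fun x hx => by simp [hx]
  simp only [true_and] at this
  rw [this, Multiset.countP_map]
  simp only [hs.hasUpperBlock_iff]
  rw [natCard_subtype]
  rfl

lemma card_lower_blocks_mul_eq_countP (v : V) (b : Option C × Multiset C) :
    Nat.card {S : {S : Set V // IsVertexBCC G S} //
      (∃ x, S.1 = upperBlock G x ∧ Par G v x) ∧ blockColor f prof S = b} * b.2.card =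
      (prof (f v)).countP fun e => (DescE prof (f v) e ∧ parC prof e.2 = some (f v)) ∧
        blockC prof e.2 = b := by
  rw [hs.card_blocks_mul (fun T => ∃ x, T = upperBlock G x ∧ Par G v x) (Par G v) b
    (fun _ h => .inl ⟨v, h⟩) fun x _ => ?_]
  · rw [← hs.natCard_eq_countP v]
    simp only [hs.par_iff]
  · constructor
    · rintro ⟨y, h, hy⟩
      exact (upperBlock_eq_iff.1 h).symm.par hy
    · exact fun h => ⟨x, rfl, h⟩

lemma card_blocks_of_mem (v : V) (b : Option C × Multiset C) :
    Nat.card {S : {S : Set V // IsVertexBCC G S} // v ∈ S.1 ∧ blockColor f prof S = b} =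
      (if HasUpperC prof (f v) ∧ blockC prof (f v) = b then 1 else 0) +
      Nat.card {S : {S : Set V // IsVertexBCC G S} //
        (∃ x, S.1 = upperBlock G x ∧ Par G v x) ∧ blockColor f prof S = b} := by
  have hone : (Finset.univ.filter fun S : {S : Set V // IsVertexBCC G S} =>
      S.1 = upperBlock G v ∧ blockColor f prof S = b).card =
      if HasUpperC prof (f v) ∧ blockC prof (f v) = b then 1 else 0 := by
    split_ifs with h
    · rw [← hs.hasUpperBlock_iff] at h
      rw [Finset.card_eq_one]
      refine ⟨⟨upperBlock G v, isVertexBCC_upperBlock h.1⟩, ?_⟩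
      ext S
      simp only [Finset.mem_filter, Finset.mem_univ, true_and, Finset.mem_singleton]
      constructor
      · exact fun h => Subtype.ext h.1
      · rintro rfl
        exact ⟨rfl, by rw [hs.blockColor_eq rfl, h.2]⟩
    · rw [Finset.card_eq_zero]
      refine Finset.eq_empty_of_forall_notMem fun S hS => h ?_
      simp only [Finset.mem_filter, Finset.mem_univ, true_and] at hS
      rw [← hs.hasUpperBlock_iff, ← hs.blockColor_eq hS.1]
      exact ⟨(mate_blockRep hS.1).hasUpperBlock (hasUpperBlock_blockRep S), hS.2⟩
  rw [← hone, natCard_subtype, natCard_subtype, ← Finset.card_union_of_disjoint]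
  · congr 1
    ext S
    simp only [Finset.mem_filter, Finset.mem_univ, true_and, Finset.mem_union, ← or_and_right]
    refine and_congr_left fun _ => ?_
    constructor
    · intro h
      rw [eq_upperBlock_blockRep S] at h
      rcases h with h | h
      · left
        rw [eq_upperBlock_blockRep S, upperBlock_eq_iff]
        exact h
      · exact .inr ⟨blockRep S, eq_upperBlock_blockRep S, h⟩
    · rintro (h | ⟨x, h, hx⟩) <;> rw [h]
      · exact mem_upperBlock_self v
      · exact .inr hx
  · rw [Finset.disjoint_filter]
    rintro S - ⟨h, -⟩ ⟨⟨x, h', hx⟩, -⟩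
    rw [h, upperBlock_eq_iff] at h'
    exact (h'.symm.par hx).1.1 rfl

lemma card_cutVertices (c : C) :
    Nat.card {v : {v : V // IsCutVertex G v} // f v.1 = c} =
      (Finset.univ.val.map f).countP fun c' => CutC prof c' ∧ c' = c := by
  rw [Multiset.countP_map, natCard_subtype]
  refine Finset.card_bij (t := Finset.univ.filter fun v => CutC prof (f v) ∧ f v = c)
    (fun v _ => v.1) (fun v hv => ?_) (fun v _ w _ h => Subtype.ext h) fun x hx => ?_
  · simp only [Finset.mem_filter, Finset.mem_univ, true_and] at hv ⊢
    exact ⟨(hs.isCutVertex_iff v.1).1 v.2, hv⟩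
  · simp only [Finset.mem_filter, Finset.mem_univ, true_and] at hx
    exact ⟨⟨x, (hs.isCutVertex_iff x).2 hx.1⟩, by simp [hx.2], rfl⟩

lemma card_cutVertices_of_mem (S : {S : Set V // IsVertexBCC G S}) (c : C) :
    Nat.card {v : {v : V // IsCutVertex G v} // v.1 ∈ S.1 ∧ f v.1 = c} =
      ((blockColor f prof S).2 + (blockColor f prof S).1.elim 0 fun c => {c}).countP
        fun c' => CutC prof c' ∧ c' = c := by
  rw [blockColor, ← hs.map_upperBlock, ← eq_upperBlock_blockRep, Multiset.countP_map,
    natCard_subtype]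
  refine Finset.card_bij (t := (Finset.univ.filter (· ∈ S.1)).filter fun v =>
      CutC prof (f v) ∧ f v = c)
    (fun v _ => v.1) (fun v hv => ?_) (fun v _ w _ h => Subtype.ext h) fun x hx => ?_
  · simp only [Finset.mem_filter, Finset.mem_univ, true_and] at hv ⊢
    exact ⟨hv.1, (hs.isCutVertex_iff v.1).1 v.2, hv.2⟩
  · simp only [Finset.mem_filter, Finset.mem_univ, true_and] at hx
    exact ⟨⟨x, (hs.isCutVertex_iff x).2 hx.2.1⟩, by simp [hx.1, hx.2.2], rfl⟩

lemma eccC_elim_lt (x : V) : (blockC prof (f x)).1.elim (-1) (eccC prof) < ecc G x := by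
  cases h : parC prof (f x) with
  | none =>
    rw [blockC, h]
    linarith [ecc_nonneg (G := G) x, show Option.elim none (-1) (eccC prof) = (-1 : ℝ) from rfl]
  | some c =>
    obtain ⟨p, rfl, hp⟩ := hs.exists_par_of_parC h
    rw [blockC, h]
    exact (hs.ecc_eq p).symm.trans_lt hp.1.ecc_lt

lemma par_of_rank_le {S : {S : Set V // IsVertexBCC G S}} {v : V} (hv : v ∈ S.1)
    (h : bcvRankC prof (.inr (f v)) ≤ bcvRankC prof (.inl (blockColor f prof S))) :
    Par G v (blockRep S) := by
  rw [eq_upperBlock_blockRep] at hv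
  refine hv.resolve_left fun hm => ?_
  have h1 := hs.eccC_elim_lt v
  rw [← hs.blockC_eq hm, hs.ecc_eq] at h1
  have h2 := (Prod.Lex.toLex_le_toLex).1 h
  rcases h2 with h2 | h2
  · exact lt_asymm h1 h2
  · exact h1.ne' h2.1

lemma mate_of_rank_le {S : {S : Set V // IsVertexBCC G S}} {v : V} (hv : v ∈ S.1)
    (h : bcvRankC prof (.inl (blockColor f prof S)) ≤ bcvRankC prof (.inr (f v))) :
    S.1 = upperBlock G v := by
  rw [eq_upperBlock_blockRep] at hv ⊢
  refine upperBlock_eq_iff.2 (hv.resolve_right fun hp => ?_)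
  have h1 : (blockColor f prof S).1.elim (-1) (eccC prof) = eccC prof (f v) := by
    rw [blockColor, blockC, hs.parC_eq_some hp]
    rfl
  have h2 := (Prod.Lex.toLex_le_toLex).1 h
  rcases h2 with h2 | h2
  · exact h2.ne h1
  · exact absurd h2.2 (by norm_num)

lemma bcvTree_rank {n n₁ n₂ : {S : Set V // IsVertexBCC G S} ⊕ {v : V // IsCutVertex G v}}
    (h₁ : (BCVTree G).Adj n n₁) (h₂ : (BCVTree G).Adj n n₂)
    (hr₁ : bcvRankC prof (bcvColor f prof n₁) ≤ bcvRankC prof (bcvColor f prof n))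
    (hr₂ : bcvRankC prof (bcvColor f prof n₂) ≤ bcvRankC prof (bcvColor f prof n)) :
    n₁ = n₂ := by
  rcases n with S | v
  · rcases n₁ with S₁ | v₁
    · exact absurd h₁ not_bcvTree_adj_inl_inl
    rcases n₂ with S₂ | v₂
    · exact absurd h₂ not_bcvTree_adj_inl_inl
    have e₁ := hs.par_of_rank_le (bcvTree_adj_inl_inr.1 h₁) hr₁
    have e₂ := hs.par_of_rank_le (bcvTree_adj_inl_inr.1 h₂) hr₂
    rw [Subtype.ext (e₁.unique e₂)]
  · rcases n₁ with S₁ | v₁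
    swap
    · exact absurd h₁ not_bcvTree_adj_inr_inr
    rcases n₂ with S₂ | v₂
    swap
    · exact absurd h₂ not_bcvTree_adj_inr_inr
    have e₁ := hs.mate_of_rank_le (bcvTree_adj_inl_inr.1 h₁.symm) hr₁
    have e₂ := hs.mate_of_rank_le (bcvTree_adj_inl_inr.1 h₂.symm) hr₂
    rw [Subtype.ext (e₁.trans e₂.symm)]

end IsStable

theorem nonempty_bcvTree_iso {W : Type u} [Fintype W] {H : SimpleGraph W} {g : W → C}
    (hs : IsStable (spdRd G) f prof) (hs' : IsStable (spdRd H) g prof)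
    (hmap : Finset.univ.val.map f = Finset.univ.val.map g) :
    Nonempty (BCVTree G ≃g BCVTree H) := by
  refine nonempty_iso_of_rank (BCVTree G) (BCVTree H) (bcvColor f prof) (bcvColor g prof)
    (bcvRankC prof) (fun c => ?_) (fun n n' h c => ?_)
    (fun _ _ _ => hs.bcvTree_rank) (fun _ _ _ => hs'.bcvTree_rank)
  · rw [natCard_subtype_sum, natCard_subtype_sum]
    rcases c with b | c
    · simp only [bcvColor, Sum.map_inl, Sum.map_inr, Sum.inl.injEq, reduceCtorEq,
        Nat.card_of_isEmpty, add_zero]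
      refine natCard_eq_of_mul_eq (k := b.2.card) ?_ ?_ ?_
      · rw [hs.card_blocks_mul_eq_countP, hs'.card_blocks_mul_eq_countP, hmap]
      · rintro S rfl
        exact hs.card_blockColor_ne_zero S
      · rintro S rfl
        exact hs'.card_blockColor_ne_zero S
    · simp only [bcvColor, Sum.map_inl, Sum.map_inr, Sum.inr.injEq, reduceCtorEq,
        Nat.card_of_isEmpty, zero_add]
      rw [hs.card_cutVertices, hs'.card_cutVertices, hmap]
  · rw [natCard_subtype_sum, natCard_subtype_sum]
    rcases n with S | v <;> rcases n' with S' | v' <;>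
      simp only [bcvColor, Sum.map_inl, Sum.map_inr, Sum.inl.injEq, Sum.inr.injEq,
        reduceCtorEq] at h
    · rcases c with b | c
      · simp [bcvColor, not_bcvTree_adj_inl_inl]
      · simp only [bcvColor, Sum.map_inl, Sum.map_inr, Sum.inr.injEq, reduceCtorEq, and_false,
          Nat.card_of_isEmpty, zero_add, bcvTree_adj_inl_inr]
        rw [hs.card_cutVertices_of_mem, hs'.card_cutVertices_of_mem, h]
    · rcases c with b | c
      · simp only [bcvColor, Sum.map_inl, Sum.map_inr, Sum.inl.injEq, reduceCtorEq, and_false,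
          Nat.card_of_isEmpty, add_zero, bcvTree_adj_inr_inl]
        rw [hs.card_blocks_of_mem, hs'.card_blocks_of_mem, h]
        congr 1
        refine natCard_eq_of_mul_eq (k := b.2.card) ?_ ?_ ?_
        · rw [hs.card_lower_blocks_mul_eq_countP, hs'.card_lower_blocks_mul_eq_countP, h]
        · rintro S ⟨-, rfl⟩
          exact hs.card_blockColor_ne_zero S
        · rintro S ⟨-, rfl⟩
          exact hs'.card_blockColor_ne_zero S
      · simp [bcvColor, not_bcvTree_adj_inr_inr]

end Trees

/-! ### Expressiveness -/

section Expressiveness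

variable {C : Type v} {hash : Multiset ((ℕ∞ × ℝ≥0∞) × C) → C} {c₀ : C} {T : ℕ → ℕ}
  {V W : Type u} [Fintype V] [Fintype W] {G : SimpleGraph V} {H : SimpleGraph W}

lemma stableBelow_of_graphRep_eq (hash_injective : Function.Injective hash) (hT : ∀ n, n ≤ T n)
    (h : graphRep (gdwlSpdRd.{u, v} hash c₀ T) G = graphRep (gdwlSpdRd.{u, v} hash c₀ T) H) :
    StableBelow hash c₀ (spdRd G) (spdRd H) (T (Fintype.card V)) := by
  have hc : Fintype.card V = Fintype.card W := by
    have := congrArg Multiset.card h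
    rw [graphRep, graphRep, Multiset.card_map, Multiset.card_map] at this
    exact this
  refine stableBelow_of_map_eq hash_injective (hT _) le_rfl ?_
  rw [graphRep, graphRep] at h
  simp only [gdwlSpdRd, ← hc] at h
  exact h

lemma card_eq_of_gdwlSpdRd_eq (hash_injective : Function.Injective hash) (hT : ∀ n, n ≤ T n)
    {a : V} {b : W} (h : gdwlSpdRd.{u, v} hash c₀ T V G a = gdwlSpdRd.{u, v} hash c₀ T W H b) :
    Fintype.card V = Fintype.card W := by
  have hV : 0 < T (Fintype.card V) := (Fintype.card_pos_iff.2 ⟨a⟩).trans_le (hT _)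
  have hW : 0 < T (Fintype.card W) := (Fintype.card_pos_iff.2 ⟨b⟩).trans_le (hT _)
  rw [gdwlSpdRd, gdwlSpdRd, ← Nat.succ_pred_eq_of_pos hV, ← Nat.succ_pred_eq_of_pos hW] at h
  have := congrArg Multiset.card (hash_injective h)
  rw [Multiset.card_map, Multiset.card_map] at this
  exact this

lemma stableBelow_of_gdwlSpdRd_eq (hash_injective : Function.Injective hash)
    (hT : ∀ n, n ≤ T n) {a : V} {b : W}
    (h : gdwlSpdRd.{u, v} hash c₀ T V G a = gdwlSpdRd.{u, v} hash c₀ T W H b) :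
    StableBelow hash c₀ (spdRd G) (spdRd H) (T (Fintype.card V)) := by
  have hc := card_eq_of_gdwlSpdRd_eq hash_injective hT h
  rw [gdwlSpdRd, gdwlSpdRd, ← hc] at h
  exact stableBelow_of_color_eq hash_injective spdRd_comm spdRd_comm spdRd_self spdRd_self (hT _) h

variable {f : V → C} {g : W → C} {prof : C → Multiset ((ℕ∞ × ℝ≥0∞) × C)}

lemma exists_color_eq (hmap : Finset.univ.val.map f = Finset.univ.val.map g) (y : W) :
    ∃ x, f x = g y := by
  have : g y ∈ Finset.univ.val.map g := Multiset.mem_map_of_mem _ (Finset.mem_univ_val y)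
  rw [← hmap] at this
  simpa using this

lemma isCutEdge_iff_br {a b : V} : IsCutEdge G s(a, b) ↔ Br G a b := by
  rw [isCutEdge_iff, SimpleGraph.mem_edgeSet, Br]
  exact and_congr_right fun h => (res_eq_one_iff h).symm

namespace IsStable

lemma connected_iff (hs : IsStable (spdRd G) f prof) [Nonempty V] :
    G.Connected ↔ ∀ x, ∀ e ∈ prof (f x), e.1.1 ≠ ⊤ := by
  simp only [hs.forall_mem_iff, spdRd_fst_ne_top_iff]
  exact ⟨fun h => h.preconnected, fun h => ⟨h⟩⟩

lemma connected_of_connected (hs : IsStable (spdRd G) f prof) (hs' : IsStable (spdRd H) g prof)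
    (hmap : Finset.univ.val.map f = Finset.univ.val.map g) (h : G.Connected) : H.Connected := by
  obtain ⟨x⟩ := h.nonempty
  obtain ⟨y, -⟩ := exists_color_eq hmap.symm x
  have : Nonempty V := ⟨x⟩
  have : Nonempty W := ⟨y⟩
  rw [hs'.connected_iff]
  intro y
  obtain ⟨x, hx⟩ := exists_color_eq hmap y
  rw [← hx]
  exact hs.connected_iff.1 h x

lemma vertexBiconnected (hs : IsStable (spdRd G) f prof) (hs' : IsStable (spdRd H) g prof)
    (hmap : Finset.univ.val.map f = Finset.univ.val.map g) (h : VertexBiconnected G) :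
    VertexBiconnected H := by
  refine ⟨hs.connected_of_connected hs' hmap h.1, fun y hy => ?_⟩
  obtain ⟨x, hx⟩ := exists_color_eq hmap y
  rw [hs'.isCutVertex_iff, ← hx, ← hs.isCutVertex_iff] at hy
  exact h.2 x hy

lemma edgeBiconnected (hs : IsStable (spdRd G) f prof) (hs' : IsStable (spdRd H) g prof)
    (hmap : Finset.univ.val.map f = Finset.univ.val.map g) (h : EdgeBiconnected G) :
    EdgeBiconnected H := by
  refine ⟨hs.connected_of_connected hs' hmap h.1, fun e he => ?_⟩
  induction e using Sym2.ind with | _ y y'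
  obtain ⟨x, hx⟩ := exists_color_eq hmap y
  have hy : ∃ e ∈ prof (g y), BrE e :=
    hs'.exists_mem_iff.2 ⟨y', (br_iff y y').1 (isCutEdge_iff_br.1 he)⟩
  rw [← hx, hs.exists_mem_iff] at hy
  obtain ⟨x', hx'⟩ := hy
  exact h.2 _ (isCutEdge_iff_br.2 ((br_iff x x').2 hx'))

lemma br_of_br (hs : IsStable (spdRd G) f prof) (hs' : IsStable (spdRd H) g prof)
    {a₁ a₂ : V} {b₁ b₂ : W} (h₁ : f a₁ = g b₁) (h₂ : f a₂ = g b₂) (hG : Br G a₁ a₂)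
    (hH : H.Adj b₁ b₂) : Br H b₁ b₂ := by
  by_contra hn
  have hB : ∀ {a₁ a₂ : V} {b₁ b₂ x : W}, f a₁ = g b₁ → f a₂ = g b₂ → Br G a₁ a₂ → g x = g b₁ →
      ∃ y, g y = g b₂ ∧ Br H x y := by
    intro a₁ a₂ b₁ b₂ x h₁ h₂ hG hx
    have : ∃ e ∈ prof (f a₁), BrE e ∧ e.2 = g b₂ :=
      hs.exists_mem_iff.2 ⟨a₂, (br_iff a₁ a₂).1 hG, h₂⟩
    rw [h₁, ← hx, hs'.exists_mem_iff] at this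
    obtain ⟨y, hy, hy'⟩ := this
    exact ⟨y, hy', (br_iff x y).2 hy⟩
  have hN : ∀ {b₁ b₂ x : W}, H.Adj b₁ b₂ → ¬ Br H b₁ b₂ → g x = g b₁ →
      ∃ y, g y = g b₂ ∧ H.Adj x y ∧ ¬ Br H x y := by
    intro b₁ b₂ x hH hn hx
    have : ∃ e ∈ prof (g b₁), e.1.1 = 1 ∧ ¬ BrE e ∧ e.2 = g b₂ :=
      hs'.exists_mem_iff.2 ⟨b₂, spdRd_fst_eq_one_iff.2 hH, (br_iff b₁ b₂).not.1 hn, rfl⟩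
    rw [← hx, hs'.exists_mem_iff] at this
    obtain ⟨y, hy, hy', hy''⟩ := this
    exact ⟨y, hy'', spdRd_fst_eq_one_iff.1 hy, (br_iff x y).not.2 hy'⟩
  have hQ : {x | g x = g b₁ ∨ g x = g b₂} = ∅ := by
    refine eq_empty_of_forall_exists_br (G := H) _ ?_ ?_
    · rintro x (hx | hx)
      · obtain ⟨y, hy, h⟩ := hB h₁ h₂ hG hx
        exact ⟨y, .inr hy, h⟩
      · obtain ⟨y, hy, h⟩ := hB h₂ h₁ hG.symm hx
        exact ⟨y, .inl hy, h⟩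
    · rintro x (hx | hx)
      · obtain ⟨y, hy, h⟩ := hN hH hn hx
        exact ⟨y, .inr hy, h⟩
      · obtain ⟨y, hy, h⟩ := hN hH.symm (fun h => hn h.symm) hx
        exact ⟨y, .inl hy, h⟩
  exact Set.notMem_empty b₁ (hQ ▸ Or.inl rfl)

end IsStable

lemma isCutEdge_of_gdwlSpdRd_eq (hash_injective : Function.Injective hash) (hT : ∀ n, n ≤ T n)
    {a₁ a₂ : V} {b₁ b₂ : W} (hH : H.Adj b₁ b₂) (hG : IsCutEdge G s(a₁, a₂))
    (h₁ : gdwlSpdRd.{u, v} hash c₀ T V G a₁ = gdwlSpdRd.{u, v} hash c₀ T W H b₁)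
    (h₂ : gdwlSpdRd.{u, v} hash c₀ T V G a₂ = gdwlSpdRd.{u, v} hash c₀ T W H b₂) :
    IsCutEdge H s(b₁, b₂) := by
  obtain ⟨f, g, prof, k, hs, hs', -, hf, hg⟩ := stableBelow_of_gdwlSpdRd_eq hash_injective hT h₁
  have hc := card_eq_of_gdwlSpdRd_eq hash_injective hT h₁
  rw [gdwlSpdRd, gdwlSpdRd, ← hc] at h₁ h₂
  exact isCutEdge_iff_br.2 (hs.br_of_br hs' (by rw [hf, hg, h₁]) (by rw [hf, hg, h₂])
    (isCutEdge_iff_br.1 hG) hH)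

variable (hash_injective : Function.Injective hash) (hT : ∀ n, n ≤ T n)

include hash_injective hT

theorem fullyExpressiveVertex_gdwlSpdRd :
    FullyExpressiveVertex (gdwlSpdRd.{u, v} hash c₀ T) := by
  refine ⟨fun V W _ _ G H hG hH h => ?_, fun V W _ _ G H a b ha hb h => ?_,
    fun V W _ _ G H hGH h => ?_⟩
  · obtain ⟨f, g, prof, k, hs, hs', hmap, -⟩ := stableBelow_of_graphRep_eq hash_injective hT h
    exact hH (hs.vertexBiconnected hs' hmap hG)
  · obtain ⟨f, g, prof, k, hs, hs', -, hf, hg⟩ := stableBelow_of_gdwlSpdRd_eq hash_injective hT h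
    rw [gdwlSpdRd, gdwlSpdRd, ← card_eq_of_gdwlSpdRd_eq hash_injective hT h] at h
    rw [hs.isCutVertex_iff, hf, h, ← hg, ← hs'.isCutVertex_iff] at ha
    exact hb ha
  · obtain ⟨f, g, prof, k, hs, hs', hmap, -⟩ := stableBelow_of_graphRep_eq hash_injective hT h
    exact hGH (nonempty_bcvTree_iso hs hs' hmap)

theorem fullyExpressiveEdge_gdwlSpdRd : FullyExpressiveEdge (gdwlSpdRd.{u, v} hash c₀ T) := by
  refine ⟨fun V W _ _ G H hG hH h => ?_, fun V W _ _ G H a₁ a₂ b₁ b₂ _ hb hG hH h => ?_,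
    fun V W _ _ G H hGH h => ?_⟩
  · obtain ⟨f, g, prof, k, hs, hs', hmap, -⟩ := stableBelow_of_graphRep_eq hash_injective hT h
    exact hH (hs.edgeBiconnected hs' hmap hG)
  · rcases Sym2.eq_iff.1 h with ⟨h₁, h₂⟩ | ⟨h₁, h₂⟩
    · exact hH (isCutEdge_of_gdwlSpdRd_eq hash_injective hT hb hG h₁ h₂)
    · rw [Sym2.eq_swap] at hH
      exact hH (isCutEdge_of_gdwlSpdRd_eq hash_injective hT hb.symm hG h₁ h₂)
  · obtain ⟨f, g, prof, k, hs, hs', hmap, -⟩ := stableBelow_of_graphRep_eq hash_injective hT h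
    exact hGH (nonempty_bceTree_iso hs hs' hmap)

end Expressiveness

end GDWL

theorem corollary4p4 {C : Type v} (hash : Multiset ((ℕ∞ × ℝ≥0∞) × C) → C)
    (hash_injective : Function.Injective hash) (c₀ : C)
    (T : ℕ → ℕ) (hT : ∀ n, n ≤ T n) :
    GDWL.FullyExpressiveVertex (GDWL.gdwlSpdRd.{u, v} hash c₀ T) ∧
      GDWL.FullyExpressiveEdge (GDWL.gdwlSpdRd.{u, v} hash c₀ T) :=
  ⟨GDWL.fullyExpressiveVertex_gdwlSpdRd hash_injective hT,
    GDWL.fullyExpressiveEdge_gdwlSpdRd hash_injective hT⟩
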